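/- Let $0<q<1$, let $\nu\ge 1$ be an integer, put $[m]_q=\frac{1-q^m}{1-q}$, $\delta=\frac{2\pi i}{\log q}$, $(z)_k=z(z+1)\cdots(z+k-1)$ (with $(z)_0=1$), let $B_k$ be the Bernoulli numbers, and let $b_x(\alpha,\beta)=\int_0^x u^{\alpha-1}(1-u)^{\beta-1}\,du$ ($0<x<1$, $\Re(\alpha)>0$). Let $\zeta_q^{(\nu)}(s)$ be the meromorphic continuation to $\mathbb{C}$ (which exists) of the series $\sum_{m\ge1}q^{m(s-\nu)}[m]_q^{-s}$, $\Re(s)>\nu$. For $t\in\mathbb{C}$ and integers $0\le j\le p$ put \[ a_j^{(p)}=a_j^{(p)}(s,t)=(s)_j\sum_{i_0+\cdots+i_j=p-j}t^{i_0}(t+1)^{i_1}\cdots(t+j)^{i_j}, \] and for integers $N\ge1$, $M\ge2$, $n\ge1$, $l_0<l_1$ put \begin{align*} R(s,t,q,N,M,n,l_0,l_1)=(\log q)^{2n-1}(1-q)^s\Biggl\{&\sum_{\substack{l<l_0\text{ or }l>l_1\\ l\ne0}}\sum_{j=0}^{2n}\sum_{k=1}^{M-1}\frac{a_j^{(2n)}}{(2\pi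 il)^{2n}}\frac{(-1)^k(s+j)_{k-1}}{(t+j+\delta l)_k}\frac{q^{N(t+j+k-1)}}{(1-q^N)^{s+j-1+k}}\\ &+\sum_{l\in\mathbb{Z}\setminus\{0\}}\sum_{j=0}^{2n}\frac{a_j^{(2n)}}{(2\pi il)^{2n}}\frac{(-1)^M(s+j)_{M-1}}{(t+j+\delta l)_{M-1}}\,b_{q^N}(t+j+\delta l+M-1,-s-j-M+2)\Biggr\}. \end{align*} Proposition. Let $N\ge1$, $M\ge2$, $n\ge1$ and $l_0<l_1$ be integers, and let $\Re(s)>\nu+1-M$. In what follows $a_j^{(p)}=a_j^{(p)}(s,s-\nu)$. (i) Suppose that $s$ is none of the points $1,\dots,\nu$ and none of the points $\nu-r+\delta l$ with $r\in\mathbb{Z}_{\ge0}$, $l\in\mathbb{Z}\setminus\{0\}$. Then both series over $l$ in $R(s,s-\nu,q,N,M,n,l_0,l_1)$ converge absolutely and \begin{align*} \zeta_q^{(\nu)}(s)=(1-q)^s\Biggl\{&\sum_{m=1}^N q^{m(s-\nu)}(1-q^m)^{-s}-\frac12q^{N(s-\nu)}(1-q^N)^{-s}+\frac1{\log q}\sum_{r=0}^{\nu-1}\frac{(-\nu+1)_r}{(-s+1)_{r+1}}q^{N(s-\nu)}(1-q^N)^{-s+1+r}\\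 &-\sum_{k=1}^n\sum_{j=0}^{2k-1}\frac{B_{2k}}{(2k)!}(\log q)^{2k-1}a_j^{(2k-1)}q^{N(s-\nu+j)}(1-q^N)^{-s-j}\\ &+(\log q)^{2n-1}\sum_{\substack{l_0\le l\le l_1\\ l\neq0}}\sum_{j=0}^{2n}\sum_{k=1}^{M-1}\frac{a_j^{(2n)}}{(2\pi il)^{2n}}\frac{(-1)^k(s+j)_{k-1}}{(s-\nu+j+\delta l)_k}\frac{q^{N(s-\nu-1+j+k)}}{(1-q^N)^{s+j-1+k}}\Biggr\}\\ &+R(s,s-\nu,q,N,M,n,l_0,l_1). \end{align*} (ii) Suppose that $\Re(s)\notin\{\nu,\nu-1,\nu-2,\dots\}$ (so that no denominator below vanishes). Then, both for $x=q^N$ and for $x=q$, $|R(s,s-\nu,q,N,M,n,l_0,l_1)|$ is at most \begin{align*} \frac{|\log q|^{2n-1}(1-q)^{\Re(s)}}{(2\pi)^{2n}}\Biggl\{&\sum_{\substack{l<l_0\text{ or }l>l_1\\ l\ne0}}\sum_{j=0}^{2n}\sum_{k=1}^{M-1}\frac{|a_j^{(2n)}|}{l^{2n}}\frac{|(s+j)_{k-1}|}{|(\Re(s)-\nu+j)_k|}\frac{q^{N(\Re(s)-\nu-1+j+k)}}{(1-q^N)^{\Re(s)+j-1+k}}\\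 &-\sum_{l\in\mathbb{Z}\setminus\{0\}}\sum_{j=0}^{2n}\frac{|a_j^{(2n)}|\,|(s+j)_{M-1}|}{l^{2n}|(\Re(s)-\nu+j)_{M-1}|}\sum_{r=0}^{\nu-1}\frac{(-\nu+1)_r}{(-\Re(s)-j-M+2)_{r+1}}\frac{x^{\Re(s)+j+M-\nu-1}}{(1-x)^{\Re(s)+j+M-2-r}}\Biggr\}, \end{align*} where the series over $l$ converge. -/

import Mathlib

noncomputable section

/-- The series `f_q(s,t) = ∑_{m ≥ 1} q^{mt} [m]_q^{-s}`, with `[m]_q = (1 - q^m) / (1 - q)`. -/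
def qSeries (q : ℝ) (s t : ℂ) : ℂ :=
  ∑' m : ℕ, (q : ℂ) ^ (((m : ℂ) + 1) * t) * (((1 - q ^ (m + 1)) / (1 - q) : ℝ) : ℂ) ^ (-s)

/-- `Z` is the meromorphic continuation to `ℂ` of `s ↦ f_q(s, s - ν)`, given by its series on
`Re s > ν`. Normal form fixes the values of `Z` everywhere (its value at a pole is `0`). -/
def IsQZeta (q : ℝ) (ν : ℕ) (Z : ℂ → ℂ) : Prop :=
  MeromorphicNFOn Z Set.univ ∧ ∀ s : ℂ, (ν : ℝ) < s.re → Z s = qSeries q s (s - ν)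

/-- The function `ζ_q^{(ν)}`: the meromorphic continuation of `s ↦ f_q(s, s - ν)`. -/
def qZeta (q : ℝ) (ν : ℕ) : ℂ → ℂ := Classical.epsilon (IsQZeta q ν)

/-- The rising factorial `(z)_k = z (z + 1) ⋯ (z + k - 1)` of a complex number. -/
def poch (z : ℂ) (k : ℕ) : ℂ := (ascPochhammer ℂ k).eval z

/-- The rising factorial of a real number. -/
def rpoch (x : ℝ) (k : ℕ) : ℝ := (ascPochhammer ℝ k).eval x

/-- `δ = 2πi / log q`. -/
def qDelta (q : ℝ) : ℂ := 2 * (Real.pi : ℂ) * Complex.I / (Real.log q : ℂ)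

/-- The points `ν - r + δ l` (`r ≥ 0`, `l ∈ ℤ`) with `l ≠ 0` or `r < ν`. For `l = 0` these are
`1, …, ν`. -/
def qZetaPoles (q : ℝ) (ν : ℕ) : Set ℂ :=
  {s | ∃ (r : ℕ) (l : ℤ), (l ≠ 0 ∨ r < ν) ∧ s = (ν : ℂ) - r + qDelta q * l}

/-- The incomplete beta function `b_x(α, β) = ∫_0^x u^{α-1} (1-u)^{β-1} du`, `0 < x < 1`. -/
def incBeta (x : ℝ) (α β : ℂ) : ℂ :=
  ∫ u in (0 : ℝ)..x, (u : ℂ) ^ (α - 1) * ((1 - u : ℝ) : ℂ) ^ (β - 1)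

/-- `a_j^{(p)} = (s)_j ∑_{i_0 + ⋯ + i_j = p - j} t^{i_0} (t+1)^{i_1} ⋯ (t+j)^{i_j}`, `j ≤ p`. -/
def aCoeff (s t : ℂ) (p j : ℕ) : ℂ :=
  poch s j * ∑ i ∈ Finset.Nat.antidiagonalTuple (j + 1) (p - j),
    ∏ r : Fin (j + 1), (t + ((r : ℕ) : ℂ)) ^ i r

/-- The `l`-th term of the elementary part of the Fourier expansion:
`∑_{j=0}^{2n} ∑_{k=1}^{M-1} a_j^{(2n)} / (2πil)^{2n} · (-1)^k (s+j)_{k-1} / (t+j+δl)_k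
  · q^{N(t+j+k-1)} / (1-q^N)^{s+j-1+k}`. -/
def fourierTerm (q : ℝ) (s t : ℂ) (N M n : ℕ) (l : ℤ) : ℂ :=
  ∑ j ∈ Finset.range (2 * n + 1), ∑ k ∈ Finset.Icc 1 (M - 1),
    aCoeff s t (2 * n) j / (2 * (Real.pi : ℂ) * Complex.I * l) ^ (2 * n)
      * ((-1) ^ k * poch (s + j) (k - 1) / poch (t + j + qDelta q * l) k)
      * ((q : ℂ) ^ ((N : ℂ) * (t + j + k - 1)) / ((1 - q ^ N : ℝ) : ℂ) ^ (s + j - 1 + k))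

/-- The `l`-th term of the incomplete beta part of the Fourier expansion:
`∑_{j=0}^{2n} a_j^{(2n)} / (2πil)^{2n} · (-1)^M (s+j)_{M-1} / (t+j+δl)_{M-1}
  · b_{q^N}(t+j+δl+M-1, -s-j-M+2)`. -/
def betaTerm (q : ℝ) (s t : ℂ) (N M n : ℕ) (l : ℤ) : ℂ :=
  ∑ j ∈ Finset.range (2 * n + 1),
    aCoeff s t (2 * n) j / (2 * (Real.pi : ℂ) * Complex.I * l) ^ (2 * n)
      * ((-1) ^ M * poch (s + j) (M - 1) / poch (t + j + qDelta q * l) (M - 1))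
      * incBeta (q ^ N) (t + j + qDelta q * l + M - 1) (-s - j - M + 2)

/-- Nonzero integers. -/
abbrev NonzeroInt : Type := {l : ℤ // l ≠ 0}

/-- Nonzero integers outside `[l₀, l₁]`. -/
abbrev OutsideInt (l₀ l₁ : ℤ) : Type := {l : ℤ // l ≠ 0 ∧ (l < l₀ ∨ l₁ < l)}

/-- The remainder `R(s,t,q,N,M,n,l₀,l₁)`. -/
def qRemainder (s t : ℂ) (q : ℝ) (N M n : ℕ) (l₀ l₁ : ℤ) : ℂ :=
  (Real.log q : ℂ) ^ (2 * n - 1) * ((1 - q : ℝ) : ℂ) ^ s *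
    ((∑' l : OutsideInt l₀ l₁, fourierTerm q s t N M n l)
      + ∑' l : NonzeroInt, betaTerm q s t N M n l)

/-- The finite main part of the approximate formula for `ζ_q^{(ν)}(s)`. -/
def qMainPart (s : ℂ) (ν : ℕ) (q : ℝ) (N M n : ℕ) (l₀ l₁ : ℤ) : ℂ :=
  ((1 - q : ℝ) : ℂ) ^ s *
    ((∑ m ∈ Finset.Icc 1 N, (q : ℂ) ^ ((m : ℂ) * (s - ν)) * ((1 - q ^ m : ℝ) : ℂ) ^ (-s))
      - 1 / 2 * (q : ℂ) ^ ((N : ℂ) * (s - ν)) * ((1 - q ^ N : ℝ) : ℂ) ^ (-s)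
      + 1 / (Real.log q : ℂ) * ∑ r ∈ Finset.range ν,
          poch (-(ν : ℂ) + 1) r / poch (-s + 1) (r + 1)
            * (q : ℂ) ^ ((N : ℂ) * (s - ν)) * ((1 - q ^ N : ℝ) : ℂ) ^ (-s + 1 + r)
      - ∑ k ∈ Finset.Icc 1 n, ∑ j ∈ Finset.range (2 * k),
          ((bernoulli (2 * k) : ℚ) : ℂ) / ((2 * k).factorial : ℂ)
            * (Real.log q : ℂ) ^ (2 * k - 1) * aCoeff s (s - ν) (2 * k - 1) j
            * (q : ℂ) ^ ((N : ℂ) * (s - ν + j)) * ((1 - q ^ N : ℝ) : ℂ) ^ (-s - j)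
      + (Real.log q : ℂ) ^ (2 * n - 1) *
          ∑ l ∈ (Finset.Icc l₀ l₁).filter (fun l => l ≠ 0), fourierTerm q s (s - ν) N M n l)

/-- The `l`-th term of the first sum in the bound:
`∑_{j=0}^{2n} ∑_{k=1}^{M-1} |a_j^{(2n)}| / l^{2n} · |(s+j)_{k-1}| / |(Re s-ν+j)_k|
  · q^{N(Re s-ν-1+j+k)} / (1-q^N)^{Re s+j-1+k}`. -/
def fourierBoundTerm (s : ℂ) (ν : ℕ) (q : ℝ) (N M n : ℕ) (l : ℤ) : ℝ :=
  ∑ j ∈ Finset.range (2 * n + 1), ∑ k ∈ Finset.Icc 1 (M - 1),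
    ‖aCoeff s (s - ν) (2 * n) j‖ / (l : ℝ) ^ (2 * n)
      * (‖poch (s + j) (k - 1)‖ / |rpoch (s.re - ν + j) k|)
      * (q ^ ((N : ℝ) * (s.re - ν - 1 + j + k)) / (1 - q ^ N) ^ (s.re + j - 1 + k))

/-- The `l`-th term of the second sum in the bound, with a parameter `x ∈ (0, 1)`:
`∑_{j=0}^{2n} |a_j^{(2n)}| |(s+j)_{M-1}| / (l^{2n} |(Re s-ν+j)_{M-1}|)
  · ∑_{r=0}^{ν-1} (-ν+1)_r / (-Re s-j-M+2)_{r+1} · x^{Re s+j+M-ν-1} / (1-x)^{Re s+j+M-2-r}`. -/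
def betaBoundTerm (s : ℂ) (ν : ℕ) (x : ℝ) (M n : ℕ) (l : ℤ) : ℝ :=
  ∑ j ∈ Finset.range (2 * n + 1),
    ‖aCoeff s (s - ν) (2 * n) j‖ * ‖poch (s + j) (M - 1)‖
        / ((l : ℝ) ^ (2 * n) * |rpoch (s.re - ν + j) (M - 1)|)
      * ∑ r ∈ Finset.range ν,
          rpoch (-(ν : ℝ) + 1) r / rpoch (-s.re - j - M + 2) (r + 1)
            * (x ^ (s.re + j + M - ν - 1) / (1 - x) ^ (s.re + j + M - 2 - r))

/-- The explicit bound for the remainder, with the parameter `x` of `betaBoundTerm`. -/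
def qRemainderBound (s : ℂ) (ν : ℕ) (q : ℝ) (N M n : ℕ) (l₀ l₁ : ℤ) (x : ℝ) : ℝ :=
  |Real.log q| ^ (2 * n - 1) * (1 - q) ^ s.re / (2 * Real.pi) ^ (2 * n) *
    ((∑' l : OutsideInt l₀ l₁, fourierBoundTerm s ν q N M n l)
      - ∑' l : NonzeroInt, betaBoundTerm s ν x M n l)

end

/-! Put `t = s - ν` and `f(x) = q^{xt} (1 - q^x)^{-s}`, so that `ζ_q^{(ν)}(s) = (1 - q)^s ∑ f(m)`
for `Re s > ν`. Euler–Maclaurin summation is applied to the tail `m > N`. The derivatives are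
`f^{(p)} = (log q)^p ∑_j a_j^{(p)} q^{x(t+j)} (1 - q^x)^{-s-j}` (`hasDerivAt_qKernelDeriv`), and the
periodic Bernoulli function in the remainder is replaced by its Fourier series
(`euler_maclaurin_tendsto`).

Under `u = q^x` the exponential `e^{2πilx}` becomes `u^{δl}`, so every integral is an incomplete
beta function. The one coming from `∫ f` has parameters with sum `1 - ν`, and a recursion in the
second parameter stops after `ν` steps (`incBeta_closed_form`). Those with `l ≠ 0` are integrated by
parts `M - 1` times (`incBeta_iterate_parts`), which raises the first parameter until they converge
for `Re s > ν + 1 - M`.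

On that half-plane the resulting formula is meromorphic: locally only finitely many `l` contribute
poles, and the remaining series converges uniformly (`exists_fourierSeries_eq_sum_add`). The
formulas for different `M` agree with the series on `Re s > ν`, hence with each other by the
identity theorem. Gluing them gives the continuation (`exists_isQZeta`), and the same argument gives
(i).

For (ii), `δl` is purely imaginary, so taking real parts factor by factor removes `l` from the
denominators. The beta integrals are bounded by real ones, whose parameters again have sum `1 - ν`
and which therefore have the same closed form. -/

noncomputable section

open Complex Filter Topology MeasureTheory

/-! ### Complete homogeneous sums and the recursion for `aCoeff`. -/

/-- The complete homogeneous symmetric sum of degree `m` in the variables `x`. -/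
def completeHomogeneous {k : ℕ} (x : Fin k → ℂ) (m : ℕ) : ℂ :=
  ∑ i ∈ Finset.Nat.antidiagonalTuple k m, ∏ r : Fin k, x r ^ i r

/-- `completeHomogeneous_succ_succ` peels off the first variable, while the recursion in `j` must
peel off the last one, `t + j`. Reversing the variables bridges the two. -/
theorem completeHomogeneous_rev {k : ℕ} (x : Fin k → ℂ) (m : ℕ) :
    completeHomogeneous (fun r => x r.rev) m = completeHomogeneous x m := by
  unfold completeHomogeneous
  refine Finset.sum_bij (fun i _ => fun r => i r.rev) ?_ ?_ ?_ ?_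
  · intro i hi
    rw [Finset.Nat.mem_antidiagonalTuple] at hi ⊢
    rw [← hi]
    exact Fintype.sum_equiv Fin.revPerm _ _ (fun r => rfl)
  · intro i _ j _ h
    funext r
    simpa using congrFun h r.rev
  · intro i hi
    refine ⟨fun r => i r.rev, ?_, by simp⟩
    rw [Finset.Nat.mem_antidiagonalTuple] at hi ⊢
    rw [← hi]
    exact Fintype.sum_equiv Fin.revPerm _ _ (fun r => rfl)
  · intro i _
    exact Fintype.prod_equiv Fin.revPerm _ _ (fun r => by simp)

theorem completeHomogeneous_zero_right {k : ℕ} (x : Fin k → ℂ) :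
    completeHomogeneous x 0 = 1 := by
  simp [completeHomogeneous, Finset.Nat.antidiagonalTuple_zero_right]

theorem completeHomogeneous_one (x : Fin 1 → ℂ) (m : ℕ) :
    completeHomogeneous x m = x 0 ^ m := by
  simp [completeHomogeneous, Finset.Nat.antidiagonalTuple_one]

theorem completeHomogeneous_succ {k : ℕ} (x : Fin (k + 1) → ℂ) (m : ℕ) :
    completeHomogeneous x m = ∑ p ∈ Finset.HasAntidiagonal.antidiagonal m,
      x 0 ^ p.1 * completeHomogeneous (fun r : Fin k => x r.succ) p.2 := by
  unfold completeHomogeneous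
  simp_rw [Finset.mul_sum]
  rw [Finset.sum_sigma']
  refine (Finset.sum_bij (fun p _ => Fin.cons p.1.1 p.2) ?_ ?_ ?_ ?_).symm
  · rintro ⟨⟨a, b⟩, i⟩ h
    simp only [Finset.mem_sigma, Finset.HasAntidiagonal.mem_antidiagonal,
      Finset.Nat.mem_antidiagonalTuple] at h
    rw [Finset.Nat.mem_antidiagonalTuple, Fin.sum_univ_succ]
    simp [h.2, h.1]
  · rintro ⟨⟨a, b⟩, i⟩ h ⟨⟨a', b'⟩, i'⟩ h' e
    simp only [Finset.mem_sigma, Finset.HasAntidiagonal.mem_antidiagonal,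
      Finset.Nat.mem_antidiagonalTuple] at h h'
    obtain ⟨e1, e2⟩ := Fin.cons_injective2 e
    simp only at e1 e2
    subst e1 e2
    have : b = b' := by omega
    subst this
    rfl
  · intro i hi
    rw [Finset.Nat.mem_antidiagonalTuple, Fin.sum_univ_succ] at hi
    refine ⟨⟨(i 0, ∑ r : Fin k, i r.succ), fun r => i r.succ⟩, ?_, ?_⟩
    · simp [Finset.Nat.mem_antidiagonalTuple, hi]
    · funext r
      refine Fin.cases ?_ (fun r => ?_) r <;> simp
  · rintro ⟨⟨a, b⟩, i⟩ _
    rw [Fin.prod_univ_succ]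
    simp

/-- A monomial of degree `m + 1` either contains the variable `x 0` or does not. -/
theorem completeHomogeneous_succ_succ {k : ℕ} (x : Fin (k + 1) → ℂ) (m : ℕ) :
    completeHomogeneous x (m + 1) = x 0 * completeHomogeneous x m
      + completeHomogeneous (fun r : Fin k => x r.succ) (m + 1) := by
  rw [completeHomogeneous_succ, Finset.Nat.sum_antidiagonal_succ, completeHomogeneous_succ x m,
    Finset.mul_sum]
  simp only [pow_zero, one_mul]
  rw [add_comm]
  congr 1
  refine Finset.sum_congr rfl fun p _ => ?_
  ring

/-- The complete homogeneous symmetric sum of degree `m` in `t, t + 1, …, t + j`. -/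
def shiftedHomogeneous (t : ℂ) (j m : ℕ) : ℂ :=
  completeHomogeneous (fun r : Fin (j + 1) => t + ((r : ℕ) : ℂ)) m

theorem aCoeff_eq (s t : ℂ) (p j : ℕ) :
    aCoeff s t p j = poch s j * shiftedHomogeneous t j (p - j) := rfl

theorem shiftedHomogeneous_zero_right (t : ℂ) (j : ℕ) : shiftedHomogeneous t j 0 = 1 :=
  completeHomogeneous_zero_right _

theorem shiftedHomogeneous_zero_left (t : ℂ) (m : ℕ) : shiftedHomogeneous t 0 m = t ^ m := by
  rw [shiftedHomogeneous, completeHomogeneous_one]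
  simp

theorem shiftedHomogeneous_succ_succ (t : ℂ) (j m : ℕ) :
    shiftedHomogeneous t (j + 1) (m + 1)
      = (t + (j + 1)) * shiftedHomogeneous t (j + 1) m + shiftedHomogeneous t j (m + 1) := by
  unfold shiftedHomogeneous
  rw [← completeHomogeneous_rev (fun r : Fin (j + 1 + 1) => t + ((r : ℕ) : ℂ)) (m + 1),
    completeHomogeneous_succ_succ,
    completeHomogeneous_rev (fun r : Fin (j + 1 + 1) => t + ((r : ℕ) : ℂ)) m,
    ← completeHomogeneous_rev (fun r : Fin (j + 1) => t + ((r : ℕ) : ℂ)) (m + 1)]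
  congr 2
  · simp [Fin.rev]
  · funext r
    simp [Fin.rev]

theorem poch_zero (z : ℂ) : poch z 0 = 1 := by simp [poch]

theorem poch_succ (z : ℂ) (k : ℕ) : poch z (k + 1) = poch z k * (z + k) :=
  ascPochhammer_succ_eval k z

theorem rpoch_zero (x : ℝ) : rpoch x 0 = 1 := by simp [rpoch]

theorem rpoch_succ (x : ℝ) (k : ℕ) : rpoch x (k + 1) = rpoch x k * (x + k) :=
  ascPochhammer_succ_eval k x

theorem aCoeff_zero_right (s t : ℂ) (p : ℕ) : aCoeff s t p 0 = t ^ p := by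
  rw [aCoeff_eq, poch_zero, shiftedHomogeneous_zero_left]
  simp

theorem aCoeff_self (s t : ℂ) (p : ℕ) : aCoeff s t p p = poch s p := by
  rw [aCoeff_eq, Nat.sub_self, shiftedHomogeneous_zero_right, mul_one]

theorem aCoeff_succ_succ (s t : ℂ) {p j : ℕ} (h : j + 1 ≤ p) :
    aCoeff s t (p + 1) (j + 1)
      = (t + (j + 1)) * aCoeff s t p (j + 1) + (s + j) * aCoeff s t p j := by
  obtain ⟨m, rfl⟩ : ∃ m, p = j + 1 + m := ⟨p - (j + 1), by omega⟩
  simp only [aCoeff_eq]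
  rw [show j + 1 + m + 1 - (j + 1) = m + 1 by omega, show j + 1 + m - (j + 1) = m by omega,
    show j + 1 + m - j = m + 1 by omega, shiftedHomogeneous_succ_succ, poch_succ]
  ring

/-- With `g j = q^{x(t+j)} (1 - q^x)^{-s-j}`, the bracket on the right is `(log q)⁻¹ · d/dx (g j)`.
This is therefore the passage from the `p`-th to the `(p+1)`-st derivative. -/
theorem sum_aCoeff_succ (s t : ℂ) (p : ℕ) (g : ℕ → ℂ) :
    ∑ j ∈ Finset.range (p + 2), aCoeff s t (p + 1) j * g j
      = ∑ j ∈ Finset.range (p + 1),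
          aCoeff s t p j * ((t + j) * g j + (s + j) * g (j + 1)) := by
  have h1 : ∑ j ∈ Finset.range (p + 1), aCoeff s t p j * ((t + j) * g j + (s + j) * g (j + 1))
      = (∑ j ∈ Finset.range (p + 1), aCoeff s t p j * ((t + j) * g j))
        + ∑ j ∈ Finset.range (p + 1), aCoeff s t p j * ((s + j) * g (j + 1)) := by
    rw [← Finset.sum_add_distrib]
    exact Finset.sum_congr rfl fun j _ => by ring
  -- The recursion covers only `1 ≤ j ≤ p`; the end coefficients `t^{p+1}` and `(s)_{p+1}` are split
  -- off.
  rw [h1, Finset.sum_range_succ, Finset.sum_range_succ', Finset.sum_range_succ' _ p,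
    Finset.sum_range_succ _ p, aCoeff_self, aCoeff_zero_right, aCoeff_self, aCoeff_zero_right]
  have h2 : ∑ j ∈ Finset.range p, aCoeff s t (p + 1) (j + 1) * g (j + 1)
      = (∑ j ∈ Finset.range p, aCoeff s t p (j + 1) * ((t + ((j + 1 : ℕ) : ℂ)) * g (j + 1)))
        + ∑ j ∈ Finset.range p, aCoeff s t p j * ((s + j) * g (j + 1)) := by
    rw [← Finset.sum_add_distrib]
    refine Finset.sum_congr rfl fun j hj => ?_
    rw [aCoeff_succ_succ s t (by have := Finset.mem_range.1 hj; omega)]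
    push_cast
    ring
  rw [h2, poch_succ]
  push_cast
  ring

/-! ### The kernel `q^{xα} (1 - q^x)^γ` and its derivatives. -/

/-- The function `x ↦ q^{xα} (1 - q^x)^γ`. -/
def qKernel (q : ℝ) (α γ : ℂ) (x : ℝ) : ℂ :=
  (q : ℂ) ^ ((x : ℂ) * α) * ((1 - q ^ x : ℝ) : ℂ) ^ γ

theorem qKernel_add {q : ℝ} (hq0 : 0 < q) (hq1 : q < 1) (α γ : ℂ) {x : ℝ} (hx : 0 < x) :
    qKernel q (α + 1) (γ - 1) x
      = qKernel q α γ x * ((q ^ x : ℝ) / (1 - q ^ x : ℝ) : ℂ) := by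
  have h1 : q ^ x < 1 := Real.rpow_lt_one hq0.le hq1 hx
  have h2 : ((1 - q ^ x : ℝ) : ℂ) ≠ 0 := by
    exact_mod_cast (sub_pos.2 h1).ne'
  unfold qKernel
  rw [mul_add, Complex.cpow_add _ _ (by exact_mod_cast hq0.ne'), Complex.cpow_sub _ _ h2, mul_one,
    Complex.cpow_one, Complex.ofReal_cpow hq0.le]
  field_simp

theorem hasDerivAt_qKernel {q : ℝ} (hq0 : 0 < q) (hq1 : q < 1) (α γ : ℂ) {x : ℝ} (hx : 0 < x) :
    HasDerivAt (qKernel q α γ)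
      ((Real.log q : ℂ) * (α * qKernel q α γ x - γ * qKernel q (α + 1) (γ - 1) x)) x := by
  have h1 : q ^ x < 1 := Real.rpow_lt_one hq0.le hq1 hx
  have h2 : ((1 - q ^ x : ℝ) : ℂ) ≠ 0 := by
    exact_mod_cast (sub_pos.2 h1).ne'
  have h3 : (q : ℂ) ≠ 0 := by exact_mod_cast hq0.ne'
  have d1 : HasDerivAt (fun y : ℝ => (q : ℂ) ^ ((y : ℂ) * α))
      ((q : ℂ) ^ ((x : ℂ) * α) * Complex.log q * (1 * α)) x :=
    (((hasDerivAt_id (x : ℂ)).mul_const α).const_cpow (Or.inl h3)).comp_ofReal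
  have d2 : HasDerivAt (fun y : ℝ => ((1 - q ^ y : ℝ) : ℂ)) ((-(q ^ x * Real.log q) : ℝ) : ℂ) x := by
    have := ((Real.hasStrictDerivAt_const_rpow hq0 x).hasDerivAt).const_sub 1
    exact this.ofReal_comp
  have d3 : HasDerivAt (fun y : ℝ => ((1 - q ^ y : ℝ) : ℂ) ^ γ)
      (γ * ((1 - q ^ x : ℝ) : ℂ) ^ (γ - 1) * ((-(q ^ x * Real.log q) : ℝ) : ℂ)) x := by
    have h4 : ((1 - q ^ x : ℝ) : ℂ) ∈ Complex.slitPlane :=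
      Complex.ofReal_mem_slitPlane.2 (sub_pos.2 h1)
    have := (Complex.hasStrictDerivAt_cpow_const (c := γ) h4).hasDerivAt
    exact this.comp x d2
  refine (d1.mul d3).congr_deriv ?_
  rw [qKernel_add hq0 hq1 _ _ hx]
  unfold qKernel
  rw [Complex.cpow_sub _ _ h2, Complex.cpow_one, ← Complex.ofReal_log hq0.le]
  push_cast
  push_cast at h2
  field_simp
  ring

/-- The `p`-th derivative of `x ↦ q^{xt} (1 - q^x)^{-s}`. -/
def qKernelDeriv (q : ℝ) (s t : ℂ) (p : ℕ) (x : ℝ) : ℂ :=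
  (Real.log q : ℂ) ^ p *
    ∑ j ∈ Finset.range (p + 1), aCoeff s t p j * qKernel q (t + j) (-s - j) x

theorem hasDerivAt_qKernelDeriv {q : ℝ} (hq0 : 0 < q) (hq1 : q < 1) (s t : ℂ) (p : ℕ) {x : ℝ}
    (hx : 0 < x) : HasDerivAt (qKernelDeriv q s t p) (qKernelDeriv q s t (p + 1) x) x := by
  have := (HasDerivAt.fun_sum (u := Finset.range (p + 1)) fun j _ =>
    (hasDerivAt_qKernel hq0 hq1 (t + j) (-s - j) hx).const_mul (aCoeff s t p j)).const_mul
      ((Real.log q : ℂ) ^ p)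
  refine this.congr_deriv ?_
  unfold qKernelDeriv
  rw [sum_aCoeff_succ s t p (fun j => qKernel q (t + j) (-s - j) x), pow_succ, mul_assoc,
    Finset.mul_sum, Finset.mul_sum, Finset.mul_sum]
  refine Finset.sum_congr rfl fun j _ => ?_
  push_cast
  rw [show t + (j + 1) = t + (j : ℂ) + 1 by ring, show -s - ((j : ℂ) + 1) = -s - j - 1 by ring]
  ring

theorem qKernelDeriv_zero (q : ℝ) (s t : ℂ) (x : ℝ) :
    qKernelDeriv q s t 0 x = qKernel q t (-s) x := by
  simp [qKernelDeriv, aCoeff_zero_right]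

/-! ### Incomplete beta integrals and the substitution `u = q^x`. -/

theorem norm_ofReal_cpow_mul_cpow {u : ℝ} (hu0 : 0 < u) (hu1 : u < 1) (a b : ℂ) :
    ‖(u : ℂ) ^ a * ((1 - u : ℝ) : ℂ) ^ b‖ = u ^ a.re * (1 - u) ^ b.re := by
  rw [norm_mul, Complex.norm_cpow_eq_rpow_re_of_pos hu0,
    Complex.norm_cpow_eq_rpow_re_of_pos (sub_pos.2 hu1)]

theorem intervalIntegrable_incBeta {x : ℝ} (hx0 : 0 < x) (hx1 : x < 1) {α : ℂ} (hα : 0 < α.re)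
    (β : ℂ) : IntervalIntegrable (fun u : ℝ => (u : ℂ) ^ (α - 1) * ((1 - u : ℝ) : ℂ) ^ (β - 1))
      volume 0 x := by
  refine (intervalIntegral.intervalIntegrable_cpow' (by simpa using hα)).mul_continuousOn ?_
  refine ContinuousOn.cpow_const (by fun_prop) fun u hu => ?_
  rw [Set.uIcc_of_le hx0.le] at hu
  exact Complex.ofReal_mem_slitPlane.2 (by linarith [hu.2])

theorem intervalIntegrable_rpow_mul_rpow {x : ℝ} (hx0 : 0 < x) (hx1 : x < 1) {a : ℝ} (ha : 0 < a)
    (b : ℝ) : IntervalIntegrable (fun u : ℝ => u ^ (a - 1) * (1 - u) ^ (b - 1)) volume 0 x := by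
  refine (intervalIntegral.intervalIntegrable_rpow' (by linarith)).mul_continuousOn ?_
  refine ContinuousOn.rpow_const (by fun_prop) fun u hu => Or.inl ?_
  rw [Set.uIcc_of_le hx0.le] at hu
  linarith [hu.2]

theorem norm_incBeta_le {x : ℝ} (hx0 : 0 < x) (hx1 : x < 1) (α β : ℂ) :
    ‖incBeta x α β‖ ≤ ∫ u in (0 : ℝ)..x, u ^ (α.re - 1) * (1 - u) ^ (β.re - 1) := by
  refine (intervalIntegral.norm_integral_le_integral_norm hx0.le).trans_eq ?_
  rw [intervalIntegral.integral_of_le hx0.le, intervalIntegral.integral_of_le hx0.le]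
  refine setIntegral_congr_fun measurableSet_Ioc fun u hu => ?_
  simpa using norm_ofReal_cpow_mul_cpow hu.1 (hu.2.trans_lt hx1) (α - 1) (β - 1)

theorem one_sub_rpow_le {u x : ℝ} (hu0 : 0 < u) (hux : u ≤ x) (hx1 : x < 1) {b B : ℝ}
    (hb : -B ≤ b) (hB : 0 ≤ B) : (1 - u) ^ b ≤ (1 - x) ^ (-B) :=
  calc (1 - u) ^ b ≤ (1 - u) ^ (-B) :=
        Real.rpow_le_rpow_of_exponent_ge (by linarith) (by linarith) hb
    _ ≤ (1 - x) ^ (-B) :=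
        Real.rpow_le_rpow_of_nonpos (by linarith) (by linarith) (by linarith)

/-- Only lower bounds on the real parts enter, so the estimate is uniform in `l` and locally uniform
in `s`. -/
theorem norm_incBeta_le_of_le {x : ℝ} (hx0 : 0 < x) (hx1 : x < 1) {α β : ℂ} {ε B : ℝ}
    (hε : 0 < ε) (hα : ε ≤ α.re) (hB : 0 ≤ B) (hβ : -B ≤ β.re - 1) :
    ‖incBeta x α β‖ ≤ (1 - x) ^ (-B) * ∫ u in (0 : ℝ)..x, u ^ (ε - 1) := by
  refine (norm_incBeta_le hx0 hx1 α β).trans ?_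
  rw [← intervalIntegral.integral_const_mul]
  refine intervalIntegral.integral_mono_on_of_le_Ioo hx0.le
    (intervalIntegrable_rpow_mul_rpow hx0 hx1 (hε.trans_le hα) _)
    ((intervalIntegral.intervalIntegrable_rpow' (by linarith)).const_mul _) fun u hu => ?_
  rw [mul_comm]
  have h1 : u < 1 := hu.2.trans hx1
  refine mul_le_mul (one_sub_rpow_le hu.1 hu.2.le hx1 hβ hB)
    (Real.rpow_le_rpow_of_exponent_ge hu.1 h1.le (by linarith))
    (Real.rpow_nonneg hu.1.le _) (Real.rpow_nonneg (by linarith) _)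

theorem qKernel_eq {q : ℝ} (hq0 : 0 < q) (α γ : ℂ) (x : ℝ) :
    qKernel q α γ x = ((q ^ x : ℝ) : ℂ) ^ α * ((1 - q ^ x : ℝ) : ℂ) ^ γ := by
  have h1 : ((q ^ x : ℝ) : ℂ) ≠ 0 := by exact_mod_cast (Real.rpow_pos_of_pos hq0 x).ne'
  have h2 : (q : ℂ) ≠ 0 := by exact_mod_cast hq0.ne'
  unfold qKernel
  congr 1
  rw [Complex.cpow_def_of_ne_zero h1, Complex.cpow_def_of_ne_zero h2,
    ← Complex.ofReal_log (Real.rpow_pos_of_pos hq0 x).le, ← Complex.ofReal_log hq0.le,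
    Real.log_rpow hq0]
  congr 1
  push_cast
  ring

theorem norm_qKernel {q : ℝ} (hq0 : 0 < q) (hq1 : q < 1) (α γ : ℂ) {x : ℝ} (hx : 0 < x) :
    ‖qKernel q α γ x‖ = q ^ (x * α.re) * (1 - q ^ x) ^ γ.re := by
  rw [qKernel_eq hq0, norm_ofReal_cpow_mul_cpow (Real.rpow_pos_of_pos hq0 x)
    (Real.rpow_lt_one hq0.le hq1 hx), Real.rpow_mul hq0.le]

/-- Since `δ log q = 2πi`, multiplying by `e^{2πilx}` shifts the exponent by `δl`. -/
theorem exp_mul_qKernel {q : ℝ} (hq0 : 0 < q) (hq1 : q < 1) (α γ : ℂ) (l : ℤ) (x : ℝ) :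
    Complex.exp (2 * Real.pi * Complex.I * l * x) * qKernel q α γ x
      = qKernel q (α + qDelta q * l) γ x := by
  have h2 : (q : ℂ) ≠ 0 := by exact_mod_cast hq0.ne'
  have h3 : (Real.log q : ℂ) ≠ 0 := by exact_mod_cast (Real.log_neg hq0 hq1).ne
  unfold qKernel
  rw [← mul_assoc]
  congr 1
  rw [Complex.cpow_def_of_ne_zero h2, Complex.cpow_def_of_ne_zero h2, ← Complex.exp_add,
    ← Complex.ofReal_log hq0.le, qDelta]
  congr 1
  field_simp
  ring

theorem tendsto_qKernel {q : ℝ} (hq0 : 0 < q) (hq1 : q < 1) {α : ℂ} (hα : 0 < α.re) (γ : ℂ) :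
    Tendsto (qKernel q α γ) atTop (𝓝 0) := by
  rw [tendsto_zero_iff_norm_tendsto_zero]
  have h1 : Tendsto (fun x : ℝ => q ^ x) atTop (𝓝 0) :=
    tendsto_rpow_atTop_of_base_lt_one q (by linarith) hq1
  have h2 : Tendsto (fun x : ℝ => q ^ (x * α.re)) atTop (𝓝 0) :=
    h1.comp (tendsto_id.atTop_mul_const hα)
  have h3 : Tendsto (fun x : ℝ => (1 - q ^ x) ^ γ.re) atTop (𝓝 1) := by
    have := (h1.const_sub 1).rpow_const (p := γ.re) (Or.inl (by norm_num))
    simpa using this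
  have h4 := h2.mul h3
  rw [zero_mul] at h4
  refine h4.congr' ?_
  filter_upwards [eventually_gt_atTop 0] with x hx
  rw [norm_qKernel hq0 hq1 α γ hx]

theorem image_rpow_Ioi {q : ℝ} (hq0 : 0 < q) (hq1 : q < 1) (a : ℝ) :
    (fun x : ℝ => q ^ x) '' Set.Ioi a = Set.Ioo 0 (q ^ a) := by
  ext u
  constructor
  · rintro ⟨x, hx, rfl⟩
    exact ⟨Real.rpow_pos_of_pos hq0 x, Real.rpow_lt_rpow_of_exponent_gt hq0 hq1 hx⟩
  · rintro ⟨h0, h1⟩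
    have e : q ^ (Real.logb q u) = u := Real.rpow_logb hq0 hq1.ne h0
    refine ⟨Real.logb q u, ?_, e⟩
    rw [← e] at h1
    exact (Real.rpow_lt_rpow_left_iff_of_base_lt_one hq0 hq1).1 h1

/-- The transformed integrand for `u = q^x`: the Jacobian supplies the factor `u` that turns the
exponent `α - 1` into `α`. -/
theorem abs_deriv_smul_incBeta {q : ℝ} (hq0 : 0 < q) (hq1 : q < 1) (α γ : ℂ) (x : ℝ) :
    |q ^ x * Real.log q| • (((q ^ x : ℝ) : ℂ) ^ (α - 1) * ((1 - q ^ x : ℝ) : ℂ) ^ (γ + 1 - 1))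
      = (-Real.log q : ℂ) * qKernel q α γ x := by
  have h1 : ((q ^ x : ℝ) : ℂ) ≠ 0 := by exact_mod_cast (Real.rpow_pos_of_pos hq0 x).ne'
  rw [qKernel_eq hq0, Complex.cpow_sub _ _ h1, Complex.cpow_one, add_sub_cancel_right,
    abs_of_neg (mul_neg_of_pos_of_neg (Real.rpow_pos_of_pos hq0 x) (Real.log_neg hq0 hq1)),
    Complex.real_smul]
  push_cast at h1 ⊢
  field_simp

theorem integrableOn_qKernel {q : ℝ} (hq0 : 0 < q) (hq1 : q < 1) {α : ℂ} (hα : 0 < α.re) (γ : ℂ)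
    {a : ℝ} (ha : 0 < a) : IntegrableOn (qKernel q α γ) (Set.Ioi a) := by
  have h := (intervalIntegrable_incBeta (Real.rpow_pos_of_pos hq0 a)
    (Real.rpow_lt_one hq0.le hq1 ha) hα (γ + 1)).1
  have h' := h.mono_set Set.Ioo_subset_Ioc_self
  rw [← image_rpow_Ioi hq0 hq1, integrableOn_image_iff_integrableOn_abs_deriv_smul
    measurableSet_Ioi
    (fun x _ => (Real.hasStrictDerivAt_const_rpow hq0 x).hasDerivAt.hasDerivWithinAt)
    (Real.strictAnti_rpow_of_base_lt_one hq0 hq1).injective.injOn] at h'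
  simp only [abs_deriv_smul_incBeta hq0 hq1] at h'
  have h3 : (-Real.log q : ℂ) ≠ 0 := by
    rw [neg_ne_zero]
    exact_mod_cast (Real.log_neg hq0 hq1).ne
  exact (integrable_const_mul_iff (Ne.isUnit h3) _).1 h'

theorem integral_qKernel {q : ℝ} (hq0 : 0 < q) (hq1 : q < 1) (α γ : ℂ) {a : ℝ} :
    ∫ x in Set.Ioi a, qKernel q α γ x
      = -(1 / (Real.log q : ℂ)) * incBeta (q ^ a) α (γ + 1) := by
  have h3 : (Real.log q : ℂ) ≠ 0 := by exact_mod_cast (Real.log_neg hq0 hq1).ne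
  rw [incBeta, intervalIntegral.integral_of_le (Real.rpow_pos_of_pos hq0 a).le,
    integral_Ioc_eq_integral_Ioo, ← image_rpow_Ioi hq0 hq1,
    integral_image_eq_integral_abs_deriv_smul measurableSet_Ioi
    (fun x _ => (Real.hasStrictDerivAt_const_rpow hq0 x).hasDerivAt.hasDerivWithinAt)
    (Real.strictAnti_rpow_of_base_lt_one hq0 hq1).injective.injOn]
  simp only [abs_deriv_smul_incBeta hq0 hq1]
  rw [integral_const_mul]
  field_simp

theorem integrableOn_qKernelDeriv {q : ℝ} (hq0 : 0 < q) (hq1 : q < 1) (s : ℂ) {t : ℂ}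
    (ht : 0 < t.re) (p : ℕ) {a : ℝ} (ha : 0 < a) :
    IntegrableOn (qKernelDeriv q s t p) (Set.Ioi a) := by
  unfold qKernelDeriv
  refine Integrable.const_mul (integrable_finsetSum _ fun j _ => Integrable.const_mul ?_ _) _
  refine integrableOn_qKernel hq0 hq1 ?_ _ ha
  simp only [add_re, natCast_re]
  positivity

theorem tendsto_qKernelDeriv {q : ℝ} (hq0 : 0 < q) (hq1 : q < 1) (s : ℂ) {t : ℂ}
    (ht : 0 < t.re) (p : ℕ) : Tendsto (qKernelDeriv q s t p) atTop (𝓝 0) := by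
  unfold qKernelDeriv
  have : Tendsto (fun x => ∑ j ∈ Finset.range (p + 1),
      aCoeff s t p j * qKernel q (t + j) (-s - j) x) atTop
      (𝓝 (∑ j ∈ Finset.range (p + 1), aCoeff s t p j * 0)) := by
    refine tendsto_finsetSum _ fun j _ => Tendsto.const_mul _ (tendsto_qKernel hq0 hq1 ?_ _)
    simp only [add_re, natCast_re]
    positivity
  simpa using this.const_mul ((Real.log q : ℂ) ^ p)

theorem exp_mul_qKernelDeriv {q : ℝ} (hq0 : 0 < q) (hq1 : q < 1) (s t : ℂ) (p : ℕ) (l : ℤ)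
    (x : ℝ) : Complex.exp (2 * Real.pi * Complex.I * l * x) * qKernelDeriv q s t p x
      = (Real.log q : ℂ) ^ p * ∑ j ∈ Finset.range (p + 1),
        aCoeff s t p j * qKernel q (t + j + qDelta q * l) (-s - j) x := by
  unfold qKernelDeriv
  simp_rw [← exp_mul_qKernel hq0 hq1, Finset.mul_sum]
  exact Finset.sum_congr rfl fun j _ => by ring

theorem qDelta_mul_re (q : ℝ) (l : ℤ) : (qDelta q * l).re = 0 := by
  simp [qDelta, Complex.div_ofReal_re]

/-- The order is `p + 1` because the substitution contributes `1 / log q`, which cancels one power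
of the logarithm. -/
theorem integral_exp_mul_qKernelDeriv {q : ℝ} (hq0 : 0 < q) (hq1 : q < 1) (s : ℂ) {t : ℂ}
    (ht : 0 < t.re) (p : ℕ) (l : ℤ) {a : ℝ} (ha : 0 < a) :
    ∫ x in Set.Ioi a, Complex.exp (2 * Real.pi * Complex.I * l * x) * qKernelDeriv q s t (p + 1) x
      = -(Real.log q : ℂ) ^ p * ∑ j ∈ Finset.range (p + 2),
        aCoeff s t (p + 1) j * incBeta (q ^ a) (t + j + qDelta q * l) (1 - s - j) := by
  have h3 : (Real.log q : ℂ) ≠ 0 := by exact_mod_cast (Real.log_neg hq0 hq1).ne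
  simp_rw [exp_mul_qKernelDeriv hq0 hq1]
  rw [integral_const_mul, integral_finsetSum]
  · simp_rw [integral_const_mul, integral_qKernel hq0 hq1, Finset.mul_sum]
    refine Finset.sum_congr rfl fun j _ => ?_
    rw [show -s - (j : ℂ) + 1 = 1 - s - j by ring]
    field_simp
    ring
  · intro j _
    refine Integrable.const_mul (integrableOn_qKernel hq0 hq1 ?_ _ ha) _
    rw [add_re, qDelta_mul_re, add_re, natCast_re]
    positivity

/-! ### Euler–Maclaurin summation with a Fourier series remainder. -/

/-- The integral `∫_0^1 B_k(x) / k! · f(x) dx`. -/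
def bernoulliIntegral (k : ℕ) (f : ℝ → ℂ) : ℂ :=
  ∫ x in (0 : ℝ)..1, ((bernoulliFun k x : ℝ) : ℂ) / (k.factorial : ℂ) * f x

theorem bernoulliIntegral_zero (f : ℝ → ℂ) :
    bernoulliIntegral 0 f = ∫ x in (0 : ℝ)..1, f x := by
  simp [bernoulliIntegral]

/-- Integration by parts, with `B_{k+1} / (k+1)!` as the primitive of `B_k / k!`. -/
theorem bernoulliIntegral_eq (k : ℕ) {f f' : ℝ → ℂ}
    (hf : ∀ x ∈ Set.Icc (0 : ℝ) 1, HasDerivAt f (f' x) x)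
    (hf' : ContinuousOn f' (Set.Icc 0 1)) :
    bernoulliIntegral k f
      = ((bernoulliFun (k + 1) 1 : ℝ) : ℂ) / ((k + 1).factorial : ℂ) * f 1
        - ((bernoulliFun (k + 1) 0 : ℝ) : ℂ) / ((k + 1).factorial : ℂ) * f 0
        - bernoulliIntegral (k + 1) f' := by
  have hu : (Set.uIcc (0 : ℝ) 1) = Set.Icc 0 1 := Set.uIcc_of_le zero_le_one
  have hd : ∀ x : ℝ, HasDerivAt
      (fun y : ℝ => ((bernoulliFun (k + 1) y : ℝ) : ℂ) / ((k + 1).factorial : ℂ))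
      (((bernoulliFun k x : ℝ) : ℂ) / (k.factorial : ℂ)) x := by
    intro x
    have := ((hasDerivAt_bernoulliFun (k + 1) x).ofReal_comp).div_const ((k + 1).factorial : ℂ)
    refine this.congr_deriv ?_
    rw [Nat.factorial_succ]
    have h1 : ((k : ℂ) + 1) ≠ 0 := by exact_mod_cast (Nat.succ_ne_zero k)
    have h2 : (k.factorial : ℂ) ≠ 0 := by exact_mod_cast (Nat.factorial_ne_zero k)
    push_cast
    field_simp
  have hc : Continuous fun x : ℝ => ((bernoulliFun k x : ℝ) : ℂ) / (k.factorial : ℂ) :=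
    (Complex.continuous_ofReal.comp (continuous_bernoulliFun k)).div_const _
  have := intervalIntegral.integral_deriv_mul_eq_sub (a := 0) (b := 1)
    (fun x _ => hd x) (fun x hx => hf x (hu ▸ hx)) (hc.intervalIntegrable _ _)
    (ContinuousOn.intervalIntegrable (hu ▸ hf'))
  have hfc : ContinuousOn f (Set.Icc 0 1) := fun x hx => (hf x hx).continuousAt.continuousWithinAt
  rw [intervalIntegral.integral_add] at this
  · rw [← this, bernoulliIntegral, bernoulliIntegral, add_sub_cancel_right]
  · exact ContinuousOn.intervalIntegrable (by rw [hu]; exact hc.continuousOn.mul hfc)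
  · refine ContinuousOn.intervalIntegrable ?_
    rw [hu]
    exact (continuous_iff_continuousAt.2 fun x => (hd x).continuousAt).continuousOn.mul hf'

theorem bernoulliFun_odd_eq_zero {k : ℕ} (hk : 1 ≤ k) :
    bernoulliFun (2 * k + 1) 0 = 0 := by
  rw [bernoulliFun_eval_zero]
  have := bernoulli_eq_zero_of_odd (n := 2 * k + 1) (by simp) (by omega)
  simp [this]

/-- The first integration by parts gives the trapezoidal term, as `B_1(0) = -1/2` and `B_1(1) =
1/2`. Afterwards the boundary terms of odd index vanish. -/
theorem euler_maclaurin_unit {f : ℕ → ℝ → ℂ}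
    (hf : ∀ p, ∀ x ∈ Set.Icc (0 : ℝ) 1, HasDerivAt (f p) (f (p + 1) x) x) {n : ℕ} (hn : 1 ≤ n) :
    ∫ x in (0 : ℝ)..1, f 0 x = (f 0 0 + f 0 1) / 2
      - (∑ k ∈ Finset.Icc 1 n, ((bernoulli (2 * k) : ℚ) : ℂ) / ((2 * k).factorial : ℂ)
          * (f (2 * k - 1) 1 - f (2 * k - 1) 0))
      + bernoulliIntegral (2 * n) (f (2 * n)) := by
  have hc : ∀ p, ContinuousOn (f p) (Set.Icc 0 1) := fun p x hx =>
    (hf p x hx).continuousAt.continuousWithinAt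
  have step : ∀ k, _ := fun k => bernoulliIntegral_eq k (hf k) (hc (k + 1))
  have odd : ∀ k, 1 ≤ k → bernoulliIntegral (2 * k) (f (2 * k))
      = -bernoulliIntegral (2 * k + 1) (f (2 * k + 1)) := by
    intro k hk
    rw [step (2 * k), bernoulliFun_endpoints_eq_of_ne_one (k := 2 * k + 1) (by omega),
      bernoulliFun_odd_eq_zero hk]
    simp
  -- Two integrations by parts at a time lead from odd order to odd order; `odd` finally moves back
  -- to order `2 * n`.
  have key : ∀ m, bernoulliIntegral 1 (f 1)
      = (∑ k ∈ Finset.Icc 1 m, ((bernoulli (2 * k) : ℚ) : ℂ) / ((2 * k).factorial : ℂ)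
          * (f (2 * k - 1) 1 - f (2 * k - 1) 0))
        + bernoulliIntegral (2 * m + 1) (f (2 * m + 1)) := by
    intro m
    induction m with
    | zero => simp
    | succ m ih =>
      rw [ih, Finset.sum_Icc_succ_top (by omega), step (2 * m + 1),
        bernoulliFun_endpoints_eq_of_ne_one (k := 2 * m + 1 + 1) (by omega),
        bernoulliFun_eval_zero, show 2 * m + 1 + 1 = 2 * (m + 1) by ring, odd (m + 1) (by omega),
        show 2 * (m + 1) - 1 = 2 * m + 1 by omega]
      push_cast
      ring
  rw [← bernoulliIntegral_zero, step 0, zero_add, key n, odd n hn]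
  simp only [bernoulliFun_one, Nat.factorial_one]
  push_cast
  ring

/-- The periodic function `x ↦ ∑_{l ≠ 0} e^{2πilx} / (2πil)^k`; the term `l = 0` vanishes for
`k ≠ 0` by the convention `1 / 0 = 0`. -/
def bernoulliFourier (k : ℕ) (x : ℝ) : ℂ :=
  ∑' l : ℤ, 1 / (2 * Real.pi * Complex.I * l) ^ k * Complex.exp (2 * Real.pi * Complex.I * l * x)

theorem norm_exp_two_pi_mul (l : ℤ) (x : ℝ) :
    ‖Complex.exp (2 * Real.pi * Complex.I * l * x)‖ = 1 := by
  rw [show (2 * Real.pi * Complex.I * l * x : ℂ) = ((2 * Real.pi * l * x : ℝ) : ℂ) * Complex.I by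
    push_cast; ring]
  exact Complex.norm_exp_ofReal_mul_I _

theorem summable_norm_one_div_two_pi_pow {k : ℕ} (hk : 2 ≤ k) :
    Summable fun l : ℤ => ‖(1 : ℂ) / (2 * Real.pi * Complex.I * l) ^ k‖ := by
  have h := ((Real.summable_one_div_int_pow.2 (by omega : 1 < k)).norm).mul_left
    (1 / (2 * Real.pi) ^ k)
  refine h.congr fun l => ?_
  simp only [norm_div, norm_one, norm_pow, norm_mul, Complex.norm_I, Complex.norm_real,
    Complex.norm_intCast, Complex.norm_ofNat, mul_pow, Real.norm_eq_abs,
    abs_of_pos Real.pi_pos]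
  simp only [one_pow, mul_one]
  rw [one_div_mul_one_div]

theorem continuous_bernoulliFourier {k : ℕ} (hk : 2 ≤ k) : Continuous (bernoulliFourier k) := by
  unfold bernoulliFourier
  refine continuous_tsum (fun l => by fun_prop) (summable_norm_one_div_two_pi_pow hk) ?_
  intro l x
  rw [norm_mul, norm_exp_two_pi_mul, mul_one]

theorem norm_bernoulliFourier_le {k : ℕ} (hk : 2 ≤ k) (x : ℝ) :
    ‖bernoulliFourier k x‖ ≤ ∑' l : ℤ, ‖(1 : ℂ) / (2 * Real.pi * Complex.I * l) ^ k‖ := by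
  refine tsum_of_norm_bounded (summable_norm_one_div_two_pi_pow hk).hasSum fun l => ?_
  rw [norm_mul, norm_exp_two_pi_mul, mul_one]

/-- For `k ≥ 2` the Fourier expansion of `B_k` holds on the closed unit interval, endpoints
included; the integer shift is absorbed by periodicity. The sign is that of the classical expansion,
and it changes the sign of the remainder integral below. -/
theorem bernoulliFourier_natCast_add {k : ℕ} (hk : 2 ≤ k) (m : ℕ) {x : ℝ}
    (hx : x ∈ Set.Icc (0 : ℝ) 1) :
    bernoulliFourier k (m + x) = -(((bernoulliFun k x : ℝ) : ℂ) / (k.factorial : ℂ)) := by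
  have h := (hasSum_one_div_pow_mul_fourier_mul_bernoulliFun hk hx).mul_left
    (1 / (2 * Real.pi * Complex.I) ^ k)
  have h0 : (2 * Real.pi * Complex.I : ℂ) ≠ 0 := Complex.two_pi_I_ne_zero
  rw [bernoulliFourier]
  refine HasSum.tsum_eq ?_
  convert! h using 1
  · funext l
    rw [fourier_coe_apply]
    have e : Complex.exp (2 * Real.pi * Complex.I * l * ((m + x : ℝ) : ℂ))
        = Complex.exp (2 * Real.pi * Complex.I * l * x / (1 : ℝ)) := by
      rw [show (2 * Real.pi * Complex.I * l * ((m + x : ℝ) : ℂ) : ℂ)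
        = 2 * Real.pi * Complex.I * l * x / (1 : ℝ)
          + ((l * m : ℤ) : ℂ) * (2 * Real.pi * Complex.I) by push_cast; ring]
      rw [Complex.exp_add, Complex.exp_int_mul_two_pi_mul_I, mul_one]
    rw [e, mul_pow _ (l : ℂ), ← mul_assoc, one_div_mul_one_div]
  · field_simp

theorem integral_eq_add_bernoulliFourier {f : ℕ → ℝ → ℂ}
    (hf : ∀ p, ∀ x : ℝ, 0 < x → HasDerivAt (f p) (f (p + 1) x) x) {n : ℕ} (hn : 1 ≤ n) {N : ℕ}
    (hN : 1 ≤ N) :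
    ∫ x in (N : ℝ)..(N + 1 : ℕ), f 0 x = (f 0 N + f 0 (N + 1 : ℕ)) / 2
      - (∑ k ∈ Finset.Icc 1 n, ((bernoulli (2 * k) : ℚ) : ℂ) / ((2 * k).factorial : ℂ)
          * (f (2 * k - 1) (N + 1 : ℕ) - f (2 * k - 1) N))
      - ∫ x in (N : ℝ)..(N + 1 : ℕ), bernoulliFourier (2 * n) x * f (2 * n) x := by
  have hN' : (0 : ℝ) < N := by exact_mod_cast hN
  have h := euler_maclaurin_unit (f := fun p x => f p (N + x)) (fun p x hx =>
    (hf p (N + x) (by linarith [hx.1])).comp_const_add (N : ℝ) x) hn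
  simp only [add_zero] at h
  have e1 : ∀ g : ℝ → ℂ, ∫ x in (N : ℝ)..(N + 1 : ℕ), g x = ∫ x in (0 : ℝ)..1, g (N + x) := by
    intro g
    rw [intervalIntegral.integral_comp_add_left]
    simp
  rw [e1, e1, h, sub_eq_add_neg _ (∫ x in (0 : ℝ)..1, _), ← intervalIntegral.integral_neg,
    bernoulliIntegral]
  push_cast
  congr 1
  refine intervalIntegral.integral_congr fun x hx => ?_
  rw [Set.uIcc_of_le zero_le_one] at hx
  rw [bernoulliFourier_natCast_add (by omega) N hx]
  ring

theorem euler_maclaurin_finite {f : ℕ → ℝ → ℂ}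
    (hf : ∀ p, ∀ x : ℝ, 0 < x → HasDerivAt (f p) (f (p + 1) x) x) {n : ℕ} (hn : 1 ≤ n) {N : ℕ}
    (hN : 1 ≤ N) (K : ℕ) :
    ∑ m ∈ Finset.range K, f 0 (N + 1 + m : ℕ)
      = (∫ x in (N : ℝ)..(N + K : ℕ), f 0 x) - f 0 N / 2 + f 0 (N + K : ℕ) / 2
        + (∑ k ∈ Finset.Icc 1 n, ((bernoulli (2 * k) : ℚ) : ℂ) / ((2 * k).factorial : ℂ)
          * (f (2 * k - 1) (N + K : ℕ) - f (2 * k - 1) N))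
        + ∫ x in (N : ℝ)..(N + K : ℕ), bernoulliFourier (2 * n) x * f (2 * n) x := by
  have hN' : (0 : ℝ) < N := by exact_mod_cast hN
  have hc : ∀ p, ContinuousOn (f p) (Set.Ioi 0) := fun p x hx =>
    (hf p x hx).continuousAt.continuousWithinAt
  have hi : ∀ (g : ℝ → ℂ), ContinuousOn g (Set.Ioi 0) → ∀ a b : ℕ, N ≤ a → N ≤ b →
      IntervalIntegrable g volume a b := by
    intro g hg a b ha hb
    refine (hg.mono fun x hx => ?_).intervalIntegrable
    have h1 : (N : ℝ) ≤ a := by exact_mod_cast ha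
    have h2 : (N : ℝ) ≤ b := by exact_mod_cast hb
    exact hN'.trans_le ((le_inf h1 h2).trans hx.1)
  have hB : ContinuousOn (fun x => bernoulliFourier (2 * n) x * f (2 * n) x) (Set.Ioi 0) :=
    (continuous_bernoulliFourier (k := 2 * n) (by omega)).continuousOn.mul (hc (2 * n))
  induction K with
  | zero => simp
  | succ K ih =>
    have h := integral_eq_add_bernoulliFourier hf hn (N := N + K) (by omega)
    rw [Finset.sum_range_succ, ih, show N + (K + 1) = N + K + 1 by ring,
      show N + 1 + K = N + K + 1 by ring,
      ← intervalIntegral.integral_add_adjacent_intervals (b := ((N + K : ℕ) : ℝ))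
        (c := ((N + K + 1 : ℕ) : ℝ))
        (hi _ (hc 0) _ _ le_rfl (by omega)) (hi _ (hc 0) _ _ (by omega) (by omega)),
      ← intervalIntegral.integral_add_adjacent_intervals (b := ((N + K : ℕ) : ℝ))
        (c := ((N + K + 1 : ℕ) : ℝ))
        (hi _ hB _ _ le_rfl (by omega)) (hi _ hB _ _ (by omega) (by omega)), h]
    have e : ∀ a b c : ℕ → ℂ, ∑ k ∈ Finset.Icc 1 n,
        ((bernoulli (2 * k) : ℚ) : ℂ) / ((2 * k).factorial : ℂ) * (a k - c k)
        = (∑ k ∈ Finset.Icc 1 n,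
        ((bernoulli (2 * k) : ℚ) : ℂ) / ((2 * k).factorial : ℂ) * (a k - b k))
        + ∑ k ∈ Finset.Icc 1 n,
        ((bernoulli (2 * k) : ℚ) : ℂ) / ((2 * k).factorial : ℂ) * (b k - c k) := by
      intro a b c
      rw [← Finset.sum_add_distrib]
      exact Finset.sum_congr rfl fun k _ => by ring
    rw [e (fun k => f (2 * k - 1) (N + K + 1 : ℕ)) (fun k => f (2 * k - 1) (N + K : ℕ))
      (fun k => f (2 * k - 1) N)]
    ring

/-- As `K → ∞` the terms at `N + K` die by `h0`. Sum and integral may be exchanged because the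
coefficients `1 / (2πil)^{2n}` are absolutely summable, the exponentials have modulus one, and `f (2
* n)` is integrable. -/
theorem euler_maclaurin_tendsto {f : ℕ → ℝ → ℂ}
    (hf : ∀ p, ∀ x : ℝ, 0 < x → HasDerivAt (f p) (f (p + 1) x) x) {n : ℕ} (hn : 1 ≤ n) {N : ℕ}
    (hN : 1 ≤ N) (h0 : ∀ p, Tendsto (f p) atTop (𝓝 0))
    (hi : ∀ p, IntegrableOn (f p) (Set.Ioi N)) :
    Tendsto (fun K => ∑ m ∈ Finset.range K, f 0 (N + 1 + m : ℕ)) atTop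
      (𝓝 ((∫ x in Set.Ioi (N : ℝ), f 0 x) - f 0 N / 2
        - (∑ k ∈ Finset.Icc 1 n, ((bernoulli (2 * k) : ℚ) : ℂ) / ((2 * k).factorial : ℂ)
          * f (2 * k - 1) N)
        + ∑' l : ℤ, 1 / (2 * Real.pi * Complex.I * l) ^ (2 * n)
          * ∫ x in Set.Ioi (N : ℝ),
            Complex.exp (2 * Real.pi * Complex.I * l * x) * f (2 * n) x)) := by
  have hk : 2 ≤ 2 * n := by omega
  have hb : Tendsto (fun K : ℕ => ((N + K : ℕ) : ℝ)) atTop atTop :=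
    tendsto_natCast_atTop_atTop.comp (tendsto_atTop_mono (fun K => Nat.le_add_left K N) tendsto_id)
  have hint : IntegrableOn (fun x => bernoulliFourier (2 * n) x * f (2 * n) x) (Set.Ioi N) :=
    (hi (2 * n)).bdd_mul (continuous_bernoulliFourier hk).aestronglyMeasurable
      (ae_of_all _ fun x => norm_bernoulliFourier_le hk x)
  have hswap : ∫ x in Set.Ioi (N : ℝ), bernoulliFourier (2 * n) x * f (2 * n) x
      = ∑' l : ℤ, 1 / (2 * Real.pi * Complex.I * l) ^ (2 * n)
          * ∫ x in Set.Ioi (N : ℝ),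
            Complex.exp (2 * Real.pi * Complex.I * l * x) * f (2 * n) x := by
    have hFi : ∀ l : ℤ, IntegrableOn (fun x : ℝ => 1 / (2 * Real.pi * Complex.I * l) ^ (2 * n)
        * (Complex.exp (2 * Real.pi * Complex.I * l * x) * f (2 * n) x)) (Set.Ioi N) := by
      intro l
      refine Integrable.const_mul ((hi (2 * n)).bdd_mul (c := 1) ?_ ?_) _
      · exact Continuous.aestronglyMeasurable (by fun_prop)
      · exact ae_of_all _ fun x => (norm_exp_two_pi_mul l x).le
    have hs : Summable fun l : ℤ => ∫ x in Set.Ioi (N : ℝ),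
        ‖1 / (2 * Real.pi * Complex.I * l) ^ (2 * n)
        * (Complex.exp (2 * Real.pi * Complex.I * l * x) * f (2 * n) x)‖ := by
      refine ((summable_norm_one_div_two_pi_pow hk).mul_right
        (∫ x in Set.Ioi (N : ℝ), ‖f (2 * n) x‖)).congr fun l => ?_
      rw [← integral_const_mul]
      refine integral_congr_ae (ae_of_all _ fun x => ?_)
      simp only
      rw [norm_mul, norm_mul, norm_exp_two_pi_mul, one_mul]
    rw [← (hasSum_integral_of_summable_integral_norm hFi hs).tsum_eq.symm.trans
      (tsum_congr fun l => integral_const_mul _ _)]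
    refine integral_congr_ae (ae_of_all _ fun x => ?_)
    simp only [bernoulliFourier]
    rw [← tsum_mul_right]
    exact tsum_congr fun l => by ring
  rw [← hswap]
  have t1 := intervalIntegral_tendsto_integral_Ioi (N : ℝ) (hi 0) hb
  have t2 := intervalIntegral_tendsto_integral_Ioi (N : ℝ) hint hb
  have t3 := ((h0 0).comp hb).div_const 2
  have t4 : Tendsto (fun K : ℕ => ∑ k ∈ Finset.Icc 1 n,
      ((bernoulli (2 * k) : ℚ) : ℂ) / ((2 * k).factorial : ℂ)
        * (f (2 * k - 1) (N + K : ℕ) - f (2 * k - 1) N)) atTop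
      (𝓝 (∑ k ∈ Finset.Icc 1 n, ((bernoulli (2 * k) : ℚ) : ℂ) / ((2 * k).factorial : ℂ)
        * (0 - f (2 * k - 1) N))) :=
    tendsto_finsetSum _ fun k _ => (((h0 (2 * k - 1)).comp hb).sub_const _).const_mul _
  have t := (((t1.sub_const (f 0 N / 2)).add t3).add t4).add t2
  simp only [euler_maclaurin_finite hf hn hN]
  refine (t.congr fun K => ?_).trans_eq (congrArg 𝓝 ?_)
  · rfl
  · simp only [zero_sub, mul_neg, Finset.sum_neg_distrib]
    ring

/-! ### Recursions for the incomplete beta function. -/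

/-- Integrate the derivative of `u^a (1-u)^b`; the boundary term at `0` vanishes because `0 < Re a`.
-/
theorem incBeta_parts {x : ℝ} (hx0 : 0 < x) (hx1 : x < 1) {a : ℂ} (ha : 0 < a.re) (b : ℂ) :
    a * incBeta x a (b + 1) - b * incBeta x (a + 1) b
      = (x : ℂ) ^ a * ((1 - x : ℝ) : ℂ) ^ b := by
  have ha0 : a ≠ 0 := fun h => by simp [h] at ha
  have hi1 := (intervalIntegrable_incBeta hx0 hx1 ha (b + 1)).const_mul a
  have hi2 := (intervalIntegrable_incBeta hx0 hx1 (α := a + 1) (by simp; linarith) b).const_mul b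
  have h := intervalIntegral.integral_eq_sub_of_hasDerivAt_of_le hx0.le
    (f := fun u : ℝ => (u : ℂ) ^ a * ((1 - u : ℝ) : ℂ) ^ b)
    (f' := fun u : ℝ => a * ((u : ℂ) ^ (a - 1) * ((1 - u : ℝ) : ℂ) ^ (b + 1 - 1))
      - b * ((u : ℂ) ^ (a + 1 - 1) * ((1 - u : ℝ) : ℂ) ^ (b - 1))) ?_ ?_ (hi1.sub hi2)
  · rw [intervalIntegral.integral_sub hi1 hi2, intervalIntegral.integral_const_mul,
      intervalIntegral.integral_const_mul] at h
    rw [incBeta, incBeta, h]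
    simp [Complex.zero_cpow ha0]
  · refine ContinuousOn.mul ?_ ?_
    · exact (Complex.continuous_ofReal_cpow_const ha).continuousOn
    · refine ContinuousOn.cpow_const (by fun_prop) fun u hu => ?_
      exact Complex.ofReal_mem_slitPlane.2 (by linarith [hu.2])
  · intro u hu
    have h1 : HasDerivAt (fun u : ℝ => (u : ℂ) ^ a) (a * (u : ℂ) ^ (a - 1)) u :=
      hasDerivAt_ofReal_cpow_const hu.1.ne' ha0
    have h2 : HasDerivAt (fun y : ℝ => ((1 - y : ℝ) : ℂ)) ((-1 : ℝ) : ℂ) u :=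
      ((hasDerivAt_id u).const_sub 1).ofReal_comp
    have h4 : ((1 - u : ℝ) : ℂ) ∈ Complex.slitPlane :=
      Complex.ofReal_mem_slitPlane.2 (by linarith [hu.2])
    have h3 := (Complex.hasStrictDerivAt_cpow_const (c := b) h4).hasDerivAt.comp u h2
    refine (h1.mul h3).congr_deriv ?_
    simp only [Function.comp_apply, add_sub_cancel_right]
    push_cast
    ring

/-- The identity `(1 - u) + u = 1` under the integral. -/
theorem incBeta_add {x : ℝ} (hx0 : 0 < x) (hx1 : x < 1) {a : ℂ} (ha : 0 < a.re) (b : ℂ) :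
    incBeta x a (b + 1) + incBeta x (a + 1) b = incBeta x a b := by
  rw [incBeta, incBeta, incBeta, ← intervalIntegral.integral_add
    (intervalIntegrable_incBeta hx0 hx1 ha (b + 1))
    (intervalIntegrable_incBeta hx0 hx1 (α := a + 1) (by simp; linarith) b)]
  rw [intervalIntegral.integral_of_le hx0.le, intervalIntegral.integral_of_le hx0.le]
  refine setIntegral_congr_fun measurableSet_Ioc fun u hu => ?_
  have h1 : (u : ℂ) ≠ 0 := by exact_mod_cast hu.1.ne'
  have h2 : ((1 - u : ℝ) : ℂ) ≠ 0 := by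
    have : 1 - u ≠ 0 := by linarith [hu.2]
    exact_mod_cast this
  simp only [add_sub_cancel_right]
  rw [Complex.cpow_sub _ _ h1, Complex.cpow_sub _ _ h2, Complex.cpow_one, Complex.cpow_one]
  field_simp
  push_cast
  ring

theorem poch_ne_zero {z : ℂ} {k : ℕ} (h : ∀ i < k, z + i ≠ 0) : poch z k ≠ 0 := by
  induction k with
  | zero => simp [poch_zero]
  | succ k ih =>
    rw [poch_succ]
    exact mul_ne_zero (ih fun i hi => h i (by omega)) (h k (by omega))

theorem poch_eq_prod (z : ℂ) (k : ℕ) : poch z k = ∏ i ∈ Finset.range k, (z + i) := by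
  induction k with
  | zero => simp [poch_zero]
  | succ k ih => rw [poch_succ, Finset.prod_range_succ, ih]

theorem rpoch_eq_prod (x : ℝ) (k : ℕ) : rpoch x k = ∏ i ∈ Finset.range k, (x + i) := by
  induction k with
  | zero => simp [rpoch_zero]
  | succ k ih => rw [rpoch_succ, Finset.prod_range_succ, ih]

theorem ofReal_rpoch (x : ℝ) (k : ℕ) : ((rpoch x k : ℝ) : ℂ) = poch x k := by
  rw [rpoch_eq_prod, poch_eq_prod]
  push_cast
  rfl

theorem poch_neg_natCast_add_one {ν : ℕ} (hν : 1 ≤ ν) : poch (-(ν : ℂ) + 1) ν = 0 := by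
  rw [poch_eq_prod, Finset.prod_eq_zero_iff]
  refine ⟨ν - 1, Finset.mem_range.2 (by omega), ?_⟩
  rw [Nat.cast_sub hν]
  push_cast
  ring

/-- Eliminating `incBeta x (a + 1) b` between `incBeta_parts` and `incBeta_add` gives `(a + b) I(b +
1) - x^a (1-x)^b = b I(b)`, where `I(b) = incBeta x a b`. With `a = w - ν` and `b = -w + 1 + n` the
factor `a + b` is `-ν + 1 + n`, which vanishes at `n = ν - 1`, so the recursion terminates. -/
theorem incBeta_closed_form {x : ℝ} (hx0 : 0 < x) (hx1 : x < 1) {ν : ℕ} (hν : 1 ≤ ν) {w : ℂ}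
    (hw : (ν : ℝ) < w.re) :
    incBeta x (w - ν) (1 - w) = -∑ r ∈ Finset.range ν,
      poch (-(ν : ℂ) + 1) r / poch (-w + 1) (r + 1)
        * (x : ℂ) ^ (w - ν) * ((1 - x : ℝ) : ℂ) ^ (-w + 1 + r) := by
  have ha : 0 < (w - ν).re := by simpa using hw
  have hne : ∀ i < ν, -w + 1 + (i : ℂ) ≠ 0 := by
    intro i hi h
    have := congrArg Complex.re h
    simp only [add_re, neg_re, one_re, natCast_re, zero_re] at this
    have h2 : (i : ℝ) + 1 ≤ ν := by exact_mod_cast hi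
    linarith
  have key : ∀ n ≤ ν, incBeta x (w - ν) (1 - w)
      = poch (-(ν : ℂ) + 1) n / poch (-w + 1) n * incBeta x (w - ν) (-w + 1 + n)
        - ∑ r ∈ Finset.range n, poch (-(ν : ℂ) + 1) r / poch (-w + 1) (r + 1)
        * (x : ℂ) ^ (w - ν) * ((1 - x : ℝ) : ℂ) ^ (-w + 1 + r) := by
    intro n
    induction n with
    | zero => intro _; simp [poch_zero, show (1 : ℂ) - w = -w + 1 by ring]
    | succ n ih =>
      intro hn
      rw [ih (by omega), Finset.sum_range_succ]
      have h1 := incBeta_parts hx0 hx1 ha (-w + 1 + n)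
      have h2 := incBeta_add hx0 hx1 ha (-w + 1 + n)
      have h3 := hne n (by omega)
      have h4 : poch (-w + 1) n ≠ 0 := poch_ne_zero fun i hi => hne i (by omega)
      have h5 : incBeta x (w - ν) (-w + 1 + n) = ((-(ν : ℂ) + 1 + n)
          * incBeta x (w - ν) (-w + 1 + n + 1)
          - (x : ℂ) ^ (w - ν) * ((1 - x : ℝ) : ℂ) ^ (-w + 1 + n : ℂ)) / (-w + 1 + n) := by
        rw [eq_div_iff h3, ← h1, ← h2]
        ring
      rw [h5, poch_succ, poch_succ, show -w + 1 + ((n + 1 : ℕ) : ℂ) = -w + 1 + n + 1 by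
        push_cast; ring]
      field_simp
      ring
  rw [key ν le_rfl, poch_neg_natCast_add_one hν]
  simp

/-- Iterating `incBeta_parts` upwards in the first parameter; the integral left over converges on a
half-plane larger by `m`. -/
theorem incBeta_iterate_parts {x : ℝ} (hx0 : 0 < x) (hx1 : x < 1) {α : ℂ} (hα : 0 < α.re) (γ : ℂ)
    (m : ℕ) :
    incBeta x α (1 - γ) = -(∑ k ∈ Finset.Icc 1 m, (-1) ^ k * poch γ (k - 1) / poch α k
        * ((x : ℂ) ^ (α + k - 1) / ((1 - x : ℝ) : ℂ) ^ (γ - 1 + k)))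
      + (-1) ^ m * poch γ m / poch α m * incBeta x (α + m) (1 - γ - m) := by
  have hne : ∀ i : ℕ, α + i ≠ 0 := by
    intro i h
    have := congrArg Complex.re h
    simp only [add_re, natCast_re, zero_re] at this
    have h2 : (0 : ℝ) ≤ i := by positivity
    linarith
  induction m with
  | zero => simp [poch_zero]
  | succ m ih =>
    have hm : 0 < (α + m).re := by
      simp only [add_re, natCast_re]
      positivity
    rw [ih, Finset.sum_Icc_succ_top (by omega)]
    have h1 := incBeta_parts hx0 hx1 hm (1 - γ - m - 1)
    have h3 := hne m
    have h4 : poch α m ≠ 0 := poch_ne_zero fun i _ => hne i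
    rw [sub_add_cancel] at h1
    have h5 : incBeta x (α + m) (1 - γ - m) = ((x : ℂ) ^ (α + m) * ((1 - x : ℝ) : ℂ) ^
        (1 - γ - m - 1) + (1 - γ - m - 1) * incBeta x (α + m + 1) (1 - γ - m - 1)) / (α + m) := by
      rw [eq_div_iff h3, ← h1]
      ring
    have h6 : (1 - γ - m - 1 : ℂ) = -(γ + m) := by ring
    rw [h5, poch_succ α, poch_succ γ, Nat.add_sub_cancel,
      show α + ((m + 1 : ℕ) : ℂ) - 1 = α + m by push_cast; ring,
      show α + ((m + 1 : ℕ) : ℂ) = α + m + 1 by push_cast; ring,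
      show 1 - γ - ((m + 1 : ℕ) : ℂ) = -(γ + m) by push_cast; ring,
      show γ - 1 + ((m + 1 : ℕ) : ℂ) = γ + m by push_cast; ring, h6, Complex.cpow_neg]
    field_simp
    ring

/-- `(q^N)^{δl} = e^{2πilN} = 1` because `N` is an integer. This is why `l` occurs in the boundary
terms only through Pochhammer denominators. -/
theorem cpow_mul_qDelta {q : ℝ} (hq0 : 0 < q) (hq1 : q < 1) (N : ℕ) (a : ℂ) (l : ℤ) :
    ((q ^ N : ℝ) : ℂ) ^ (a + qDelta q * l) = (q : ℂ) ^ ((N : ℂ) * a) := by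
  have hN : (0 : ℝ) < q ^ N := pow_pos hq0 N
  have h1 : ((q ^ N : ℝ) : ℂ) ≠ 0 := by exact_mod_cast hN.ne'
  have h2 : (q : ℂ) ≠ 0 := by exact_mod_cast hq0.ne'
  have h3 : (Real.log q : ℂ) ≠ 0 := by exact_mod_cast (Real.log_neg hq0 hq1).ne
  rw [Complex.cpow_def_of_ne_zero h1, Complex.cpow_def_of_ne_zero h2,
    ← Complex.ofReal_log hN.le, ← Complex.ofReal_log hq0.le, Real.log_pow, qDelta,
    show ((N * Real.log q : ℝ) : ℂ) * (a + 2 * Real.pi * Complex.I / (Real.log q : ℂ) * l)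
      = Real.log q * (N * a) + ((N * l : ℤ) : ℂ) * (2 * Real.pi * Complex.I) by
      push_cast; field_simp, Complex.exp_add, Complex.exp_int_mul_two_pi_mul_I, mul_one]

theorem fourierTerm_add_betaTerm {q : ℝ} (hq0 : 0 < q) (hq1 : q < 1) (s : ℂ) {t : ℂ}
    (ht : 0 < t.re) {N M : ℕ} (hN : 1 ≤ N) (hM : 1 ≤ M) (n : ℕ) (l : ℤ) :
    fourierTerm q s t N M n l + betaTerm q s t N M n l
      = -(∑ j ∈ Finset.range (2 * n + 1),
          aCoeff s t (2 * n) j * incBeta (q ^ N) (t + j + qDelta q * l) (1 - s - j))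
        / (2 * Real.pi * Complex.I * l) ^ (2 * n) := by
  rw [fourierTerm, betaTerm, ← Finset.sum_add_distrib, ← Finset.sum_neg_distrib, Finset.sum_div]
  refine Finset.sum_congr rfl fun j _ => ?_
  have hα : 0 < (t + j + qDelta q * l).re := by
    rw [add_re, qDelta_mul_re, add_re, natCast_re]
    positivity
  have h := incBeta_iterate_parts (pow_pos hq0 N) (pow_lt_one₀ hq0.le hq1 (by omega)) hα (s + j)
    (M - 1)
  rw [show 1 - s - (j : ℂ) = 1 - (s + j) by ring, h]
  obtain ⟨m, rfl⟩ : ∃ m, M = m + 1 := ⟨M - 1, by omega⟩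
  rw [Nat.add_sub_cancel, show t + j + qDelta q * l + ((m + 1 : ℕ) : ℂ) - 1
      = t + j + qDelta q * l + m by push_cast; ring,
    show -s - j - ((m + 1 : ℕ) : ℂ) + 2 = 1 - (s + j) - m by push_cast; ring]
  have e : ∀ k ∈ Finset.Icc 1 m, (-1) ^ k * poch (s + j) (k - 1) / poch (t + j + qDelta q * l) k
        * (((q ^ N : ℝ) : ℂ) ^ (t + j + qDelta q * l + k - 1)
          / ((1 - q ^ N : ℝ) : ℂ) ^ (s + j - 1 + k))
      = (-1) ^ k * poch (s + j) (k - 1) / poch (t + j + qDelta q * l) k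
      * ((q : ℂ) ^ ((N : ℂ) * (t + j + k - 1)) / ((1 - q ^ N : ℝ) : ℂ) ^ (s + j - 1 + k)) := by
    intro k _
    rw [show t + j + qDelta q * l + k - 1 = t + j + k - 1 + qDelta q * l by ring,
      cpow_mul_qDelta hq0 hq1]
  rw [Finset.sum_congr rfl e]
  simp_rw [mul_assoc (aCoeff s t (2 * n) j / (2 * Real.pi * Complex.I * l) ^ (2 * n))]
  rw [← Finset.mul_sum]
  ring

/-! ### The formula in the region `Re s > ν`. -/

theorem summable_qKernel {q : ℝ} (hq0 : 0 < q) (hq1 : q < 1) {α : ℂ} (hα : 0 < α.re) (γ : ℂ) :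
    Summable fun m : ℕ => qKernel q α γ ((m + 1 : ℕ) : ℝ) := by
  have hg : Summable fun m : ℕ => (1 - q) ^ (-|γ.re|) * (q ^ α.re) ^ (m + 1) := by
    refine Summable.mul_left _ ((summable_nat_add_iff 1).2 ?_)
    exact summable_geometric_of_lt_one (Real.rpow_nonneg hq0.le _)
      (Real.rpow_lt_one hq0.le hq1 hα)
  refine Summable.of_norm_bounded hg fun m => ?_
  have hm : (0 : ℝ) < ((m + 1 : ℕ) : ℝ) := by positivity
  rw [norm_qKernel hq0 hq1 α γ hm, mul_comm, mul_comm (((m + 1 : ℕ) : ℝ)), Real.rpow_mul hq0.le,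
    Real.rpow_natCast, Real.rpow_natCast]
  refine mul_le_mul_of_nonneg_right ?_ (by positivity)
  refine one_sub_rpow_le (pow_pos hq0 _) ?_ hq1 (neg_abs_le _) (abs_nonneg _)
  exact pow_le_of_le_one hq0.le hq1.le (by omega)

theorem qSeries_eq {q : ℝ} (hq0 : 0 < q) (hq1 : q < 1) (s t : ℂ) :
    qSeries q s t = ((1 - q : ℝ) : ℂ) ^ s * ∑' m : ℕ, qKernel q t (-s) ((m + 1 : ℕ) : ℝ) := by
  have h1 : ((1 - q : ℝ) : ℂ) ≠ 0 := by exact_mod_cast (sub_pos.2 hq1).ne'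
  rw [qSeries, ← tsum_mul_left]
  refine tsum_congr fun m => ?_
  have h2 : 0 ≤ 1 - q ^ (m + 1) := sub_nonneg.2 (pow_le_one₀ hq0.le hq1.le)
  rw [div_eq_mul_inv, Complex.ofReal_mul, Complex.mul_cpow_ofReal_nonneg h2
    (inv_nonneg.2 (sub_nonneg.2 hq1.le)), Complex.ofReal_inv,
    Complex.inv_cpow _ _ (by
      rw [Complex.arg_ofReal_of_nonneg (sub_nonneg.2 hq1.le)]
      exact Real.pi_ne_zero.symm),
    Complex.cpow_neg (((1 - q : ℝ) : ℂ)), inv_inv, qKernel, Real.rpow_natCast]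
  push_cast
  ring

/-- The part of `qMainPart` without its Fourier terms and without the factor `(1 - q)^s`. -/
def qElementaryPart (s : ℂ) (ν : ℕ) (q : ℝ) (N n : ℕ) : ℂ :=
  (∑ m ∈ Finset.Icc 1 N, (q : ℂ) ^ ((m : ℂ) * (s - ν)) * ((1 - q ^ m : ℝ) : ℂ) ^ (-s))
    - 1 / 2 * (q : ℂ) ^ ((N : ℂ) * (s - ν)) * ((1 - q ^ N : ℝ) : ℂ) ^ (-s)
    + 1 / (Real.log q : ℂ) * ∑ r ∈ Finset.range ν,
        poch (-(ν : ℂ) + 1) r / poch (-s + 1) (r + 1)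
          * (q : ℂ) ^ ((N : ℂ) * (s - ν)) * ((1 - q ^ N : ℝ) : ℂ) ^ (-s + 1 + r)
    - ∑ k ∈ Finset.Icc 1 n, ∑ j ∈ Finset.range (2 * k),
        ((bernoulli (2 * k) : ℚ) : ℂ) / ((2 * k).factorial : ℂ)
          * (Real.log q : ℂ) ^ (2 * k - 1) * aCoeff s (s - ν) (2 * k - 1) j
          * (q : ℂ) ^ ((N : ℂ) * (s - ν + j)) * ((1 - q ^ N : ℝ) : ℂ) ^ (-s - j)

theorem qKernel_natCast (q : ℝ) (α γ : ℂ) (m : ℕ) :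
    qKernel q α γ m = (q : ℂ) ^ ((m : ℂ) * α) * ((1 - q ^ m : ℝ) : ℂ) ^ γ := by
  rw [qKernel, Real.rpow_natCast, Complex.ofReal_natCast]

theorem qSeries_eq_of_lt_re {q : ℝ} (hq0 : 0 < q) (hq1 : q < 1) {ν : ℕ} (hν : 1 ≤ ν) {N M n : ℕ}
    (hN : 1 ≤ N) (hM : 1 ≤ M) (hn : 1 ≤ n) {s : ℂ} (hs : (ν : ℝ) < s.re) :
    qSeries q s (s - ν) = ((1 - q : ℝ) : ℂ) ^ s * (qElementaryPart s ν q N n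
      + (Real.log q : ℂ) ^ (2 * n - 1) *
        ∑' l : ℤ, (fourierTerm q s (s - ν) N M n l + betaTerm q s (s - ν) N M n l)) := by
  have ht : 0 < (s - ν).re := by simpa using hs
  have hN' : (0 : ℝ) < N := by exact_mod_cast hN
  have hlim := euler_maclaurin_tendsto (f := qKernelDeriv q s (s - ν))
    (fun p x hx => hasDerivAt_qKernelDeriv hq0 hq1 s _ p hx) hn hN
    (tendsto_qKernelDeriv hq0 hq1 s ht)
    (fun p => integrableOn_qKernelDeriv hq0 hq1 s ht p hN')
  have hsum := summable_qKernel hq0 hq1 ht (-s)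
  have hshift : Summable fun m : ℕ => qKernel q (s - ν) (-s) ((N + 1 + m : ℕ) : ℝ) := by
    refine ((summable_nat_add_iff N).2 hsum).congr fun m => ?_
    rw [show m + N + 1 = N + 1 + m by ring]
  have hsplit : ∑' m : ℕ, qKernel q (s - ν) (-s) ((m + 1 : ℕ) : ℝ)
      = (∑ m ∈ Finset.Icc 1 N, qKernel q (s - ν) (-s) m)
        + ∑' m : ℕ, qKernel q (s - ν) (-s) ((N + 1 + m : ℕ) : ℝ) := by
    rw [← hsum.sum_add_tsum_nat_add N, Finset.range_eq_Ico,
      Finset.sum_Ico_add' (fun m : ℕ => qKernel q (s - ν) (-s) (m : ℝ)) 0 N 1]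
    congr 1
    exact tsum_congr fun m => by rw [show m + N + 1 = N + 1 + m by ring]
  -- The partial sums of the tail converge both to its sum and to the Euler–Maclaurin expression.
  have heq := tendsto_nhds_unique (hshift.hasSum.tendsto_sum_nat)
    (hlim.congr fun K => Finset.sum_congr rfl fun m _ => qKernelDeriv_zero _ _ _ _)
  rw [qSeries_eq hq0 hq1, hsplit, heq]
  congr 1
  simp_rw [qKernelDeriv_zero]
  rw [integral_qKernel hq0 hq1, Real.rpow_natCast,
    show -s + 1 = 1 - s by ring,
    incBeta_closed_form (pow_pos hq0 N) (pow_lt_one₀ hq0.le hq1 (by omega)) hν hs,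
    ← tsum_mul_left, qElementaryPart]
  -- This also covers `l = 0`, where both sides vanish through division by zero.
  have e1 : ∀ l : ℤ, (Real.log q : ℂ) ^ (2 * n - 1)
      * (fourierTerm q s (s - ν) N M n l + betaTerm q s (s - ν) N M n l)
      = 1 / (2 * Real.pi * Complex.I * l) ^ (2 * n) * ∫ x in Set.Ioi (N : ℝ),
        Complex.exp (2 * Real.pi * Complex.I * l * x) * qKernelDeriv q s (s - ν) (2 * n) x := by
    intro l
    have := integral_exp_mul_qKernelDeriv hq0 hq1 s ht (2 * n - 1) l hN'
    rw [show 2 * n - 1 + 1 = 2 * n by omega, show 2 * n - 1 + 2 = 2 * n + 1 by omega] at this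
    rw [this, fourierTerm_add_betaTerm hq0 hq1 s ht hN hM, Real.rpow_natCast]
    ring
  have e2 : ∀ k ∈ Finset.Icc 1 n, ((bernoulli (2 * k) : ℚ) : ℂ) / ((2 * k).factorial : ℂ)
        * qKernelDeriv q s (s - ν) (2 * k - 1) N
      = ∑ j ∈ Finset.range (2 * k), ((bernoulli (2 * k) : ℚ) : ℂ) / ((2 * k).factorial : ℂ)
          * (Real.log q : ℂ) ^ (2 * k - 1) * aCoeff s (s - ν) (2 * k - 1) j
          * (q : ℂ) ^ ((N : ℂ) * (s - ν + j)) * ((1 - q ^ N : ℝ) : ℂ) ^ (-s - j) := by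
    intro k hk
    have hk1 := (Finset.mem_Icc.1 hk).1
    rw [qKernelDeriv, Nat.sub_add_cancel (by omega), Finset.mul_sum, Finset.mul_sum]
    refine Finset.sum_congr rfl fun j _ => ?_
    rw [qKernel_natCast]
    ring
  have e3 : ((q ^ N : ℝ) : ℂ) ^ (s - ν) = (q : ℂ) ^ ((N : ℂ) * (s - ν)) := by
    have := cpow_mul_qDelta hq0 hq1 N (s - ν) 0
    simpa using this
  rw [tsum_congr e1, Finset.sum_congr rfl e2, e3]
  simp_rw [qKernel_natCast]
  ring

/-! ### Analyticity in `s` of the incomplete beta function and of each term. -/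

/-- Differentiating `u^{s+c-1}` in `s` produces `log u`; half of the exponent `ε` is spent on
absorbing it, and the other half keeps the bound integrable at `0`. -/
theorem abs_log_mul_rpow_le {u : ℝ} (hu0 : 0 < u) (hu1 : u ≤ 1) {ε : ℝ} (hε : 0 < ε) :
    u ^ (ε - 1) * |Real.log u| ≤ 2 / ε * u ^ (ε / 2 - 1) := by
  have h := (Real.abs_log_mul_self_rpow_lt u (ε / 2) hu0 hu1 (by positivity)).le
  rw [abs_mul, abs_of_pos (Real.rpow_pos_of_pos hu0 _)] at h
  rw [show ε - 1 = ε / 2 + (ε / 2 - 1) by ring, Real.rpow_add hu0]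
  have h2 := Real.rpow_nonneg hu0.le (ε / 2 - 1)
  calc u ^ (ε / 2) * u ^ (ε / 2 - 1) * |Real.log u|
      = |Real.log u| * u ^ (ε / 2) * u ^ (ε / 2 - 1) := by ring
    _ ≤ 1 / (ε / 2) * u ^ (ε / 2 - 1) := mul_le_mul_of_nonneg_right h h2
    _ = 2 / ε * u ^ (ε / 2 - 1) := by field_simp

theorem norm_incBeta_integrand_mul_log_le {x u : ℝ} (hu0 : 0 < u) (hux : u ≤ x) (hx1 : x < 1)
    {α β : ℂ} {ε B : ℝ} (hε : 0 < ε) (hα : ε ≤ α.re) (hB : 0 ≤ B) (hβ : -B ≤ β.re - 1) :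
    ‖(u : ℂ) ^ (α - 1) * ((1 - u : ℝ) : ℂ) ^ (β - 1) * (Real.log u - Real.log (1 - u) : ℂ)‖
      ≤ (1 - x) ^ (-B) * (2 / ε + |Real.log (1 - x)|) * u ^ (ε / 2 - 1) := by
  have hu1 : u < 1 := hux.trans_lt hx1
  have hB' := Real.rpow_nonneg (by linarith : 0 ≤ 1 - x) (-B)
  have h0 := Real.rpow_nonneg hu0.le (ε - 1)
  have h1 : u ^ (α.re - 1) ≤ u ^ (ε - 1) :=
    Real.rpow_le_rpow_of_exponent_ge hu0 hu1.le (by linarith)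
  have h2 := one_sub_rpow_le hu0 hux hx1 hβ hB
  have h3 : u ^ (ε - 1) ≤ u ^ (ε / 2 - 1) :=
    Real.rpow_le_rpow_of_exponent_ge hu0 hu1.le (by linarith)
  have h4 : |Real.log (1 - u)| ≤ |Real.log (1 - x)| := by
    rw [abs_of_neg (Real.log_neg (by linarith) (by linarith)),
      abs_of_neg (Real.log_neg (by linarith) (by linarith))]
    exact neg_le_neg (Real.log_le_log (by linarith) (by linarith))
  have h5 : ‖(Real.log u - Real.log (1 - u) : ℂ)‖ ≤ |Real.log u| + |Real.log (1 - x)| := by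
    rw [← Complex.ofReal_sub, Complex.norm_real, Real.norm_eq_abs]
    exact (abs_sub _ _).trans (by linarith)
  rw [norm_mul, norm_ofReal_cpow_mul_cpow hu0 hu1]
  simp only [sub_re, one_re]
  calc u ^ (α.re - 1) * (1 - u) ^ (β.re - 1) * ‖(Real.log u - Real.log (1 - u) : ℂ)‖
      ≤ u ^ (ε - 1) * (1 - x) ^ (-B) * (|Real.log u| + |Real.log (1 - x)|) := by
        refine mul_le_mul (mul_le_mul h1 h2 (Real.rpow_nonneg (by linarith) _) h0) h5
          (norm_nonneg _) (mul_nonneg h0 hB')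
    _ = (1 - x) ^ (-B) * (u ^ (ε - 1) * |Real.log u| + |Real.log (1 - x)| * u ^ (ε - 1)) := by ring
    _ ≤ (1 - x) ^ (-B)
        * (2 / ε * u ^ (ε / 2 - 1) + |Real.log (1 - x)| * u ^ (ε / 2 - 1)) := by
        refine mul_le_mul_of_nonneg_left (add_le_add (abs_log_mul_rpow_le hu0 hu1.le hε)
          (mul_le_mul_of_nonneg_left h3 (abs_nonneg _))) hB'
    _ = _ := by ring

theorem differentiableAt_incBeta {x : ℝ} (hx0 : 0 < x) (hx1 : x < 1) (c d : ℂ) {s₀ : ℂ}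
    (hs : 0 < (s₀ + c).re) : DifferentiableAt ℂ (fun s => incBeta x (s + c) (d - s)) s₀ := by
  -- Half the distance from `s₀` to the line where convergence fails, so that `Re (s + c) ≥ ε` on
  -- the whole ball of radius `ε`; `B` likewise controls the exponent of `1 - u` there.
  set ε := (s₀ + c).re / 2 with hε_def
  have hε : 0 < ε := by positivity
  set B := |(d - s₀).re - 1| + ε
  have hB : 0 ≤ B := by positivity
  have hball : ∀ s ∈ Metric.ball s₀ ε, ε ≤ (s + c).re ∧ -B ≤ (d - s).re - 1 := by
    intro s hs
    have h1 : |(s - s₀).re| < ε :=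
      (Complex.abs_re_le_norm _).trans_lt (by rwa [← dist_eq_norm])
    have h2 := abs_lt.1 h1
    have h3 := neg_abs_le ((d - s₀).re - 1)
    simp only [sub_re, add_re] at *
    constructor
    · linarith
    · show -(|d.re - s₀.re - 1| + ε) ≤ _
      linarith
  have hmeas : ∀ s ∈ Metric.ball s₀ ε, IntegrableOn
      (fun u : ℝ => (u : ℂ) ^ (s + c - 1) * ((1 - u : ℝ) : ℂ) ^ (d - s - 1)) (Set.Ioc 0 x) :=
    fun s hs => (intervalIntegrable_incBeta hx0 hx1 (hε.trans_le (hball s hs).1) (d - s)).1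
  have hi := hmeas s₀ (Metric.mem_ball_self hε)
  have key := hasDerivAt_integral_of_dominated_loc_of_deriv_le
    (μ := volume.restrict (Set.Ioc 0 x)) (x₀ := s₀) (s := Metric.ball s₀ ε)
    (F := fun s (u : ℝ) => (u : ℂ) ^ (s + c - 1) * ((1 - u : ℝ) : ℂ) ^ (d - s - 1))
    (F' := fun s (u : ℝ) => (u : ℂ) ^ (s + c - 1) * ((1 - u : ℝ) : ℂ) ^ (d - s - 1)
      * (Real.log u - Real.log (1 - u) : ℂ))
    (bound := fun u => (1 - x) ^ (-B) * (2 / ε + |Real.log (1 - x)|) * u ^ (ε / 2 - 1))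
    (Metric.ball_mem_nhds _ hε)
    (by filter_upwards [Metric.ball_mem_nhds s₀ hε] with s hs using (hmeas s hs).1)
    hi
    (hi.1.mul (Measurable.aestronglyMeasurable (by fun_prop)))
    ?_ ?_ ?_
  · have e : (fun s => incBeta x (s + c) (d - s)) = fun s => ∫ u in Set.Ioc 0 x,
        (u : ℂ) ^ (s + c - 1) * ((1 - u : ℝ) : ℂ) ^ (d - s - 1) := by
      funext s
      rw [incBeta, intervalIntegral.integral_of_le hx0.le]
    rw [e]
    exact key.2.differentiableAt
  · filter_upwards [ae_restrict_mem measurableSet_Ioc] with u hu s hs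
    exact norm_incBeta_integrand_mul_log_le hu.1 hu.2 hx1 hε (hball s hs).1 hB (hball s hs).2
  · exact (((intervalIntegral.intervalIntegrable_rpow' (by linarith)).const_mul _).1)
  · filter_upwards [ae_restrict_mem measurableSet_Ioc] with u hu s _
    have h1 : (u : ℂ) ≠ 0 := by exact_mod_cast hu.1.ne'
    have h2 : ((1 - u : ℝ) : ℂ) ≠ 0 := by
      have : 1 - u ≠ 0 := by linarith [hu.2]
      exact_mod_cast this
    have d1 := (((hasDerivAt_id s).add_const c).sub_const 1).const_cpow (c := (u : ℂ)) (Or.inl h1)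
    have d2 := (((hasDerivAt_id s).const_sub d).sub_const 1).const_cpow
      (c := ((1 - u : ℝ) : ℂ)) (Or.inl h2)
    refine (d1.mul d2).congr_deriv ?_
    rw [← Complex.ofReal_log hu.1.le, ← Complex.ofReal_log (by linarith [hu.2] : 0 ≤ 1 - u)]
    simp only [id]
    ring

theorem analyticAt_incBeta {x : ℝ} (hx0 : 0 < x) (hx1 : x < 1) (c d : ℂ) {s₀ : ℂ}
    (hs : 0 < (s₀ + c).re) : AnalyticAt ℂ (fun s => incBeta x (s + c) (d - s)) s₀ := by
  have ho : IsOpen {s : ℂ | 0 < (s + c).re} :=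
    isOpen_lt continuous_const (Complex.continuous_re.comp (continuous_add_const c))
  have hd : DifferentiableOn ℂ (fun s => incBeta x (s + c) (d - s)) {s : ℂ | 0 < (s + c).re} :=
    fun s hs => (differentiableAt_incBeta hx0 hx1 c d hs).differentiableWithinAt
  exact hd.analyticAt (ho.mem_nhds hs)

theorem differentiable_poch (k : ℕ) : Differentiable ℂ fun z => poch z k :=
  Polynomial.differentiable _

theorem differentiable_aCoeff (ν p j : ℕ) : Differentiable ℂ fun s => aCoeff s (s - ν) p j := by
  unfold aCoeff
  have := differentiable_poch j
  fun_prop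

theorem differentiable_qPow {q : ℝ} (hq0 : 0 < q) (hq1 : q < 1) {N : ℕ} (hN : 1 ≤ N)
    (ν : ℕ) (c d e : ℂ) : Differentiable ℂ fun s =>
      (q : ℂ) ^ (c * (s - ν + d)) / ((1 - q ^ N : ℝ) : ℂ) ^ (s + e) := by
  have h1 : (q : ℂ) ≠ 0 := by exact_mod_cast hq0.ne'
  have h2 : ((1 - q ^ N : ℝ) : ℂ) ≠ 0 := by
    have : 1 - q ^ N ≠ 0 := (sub_pos.2 (pow_lt_one₀ hq0.le hq1 (by omega))).ne'
    exact_mod_cast this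
  intro s
  refine DifferentiableAt.div (DifferentiableAt.const_cpow (by fun_prop) (Or.inl h1))
    (DifferentiableAt.const_cpow (by fun_prop) (Or.inl h2)) ?_
  rw [Complex.cpow_def_of_ne_zero h2]
  exact Complex.exp_ne_zero _

/-- The coefficient of `1 / ((2πil)^{2n} (s-ν+j+δl)_k)` in `fourierTerm`. -/
def fourierCoefficient (q : ℝ) (ν N n j k : ℕ) (s : ℂ) : ℂ :=
  aCoeff s (s - ν) (2 * n) j * ((-1) ^ k * poch (s + j) (k - 1))
    * ((q : ℂ) ^ ((N : ℂ) * (s - ν + (j + k - 1))) / ((1 - q ^ N : ℝ) : ℂ) ^ (s + (j - 1 + k)))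

/-- The coefficient of `1 / ((2πil)^{2n} (s-ν+j+δl)_{M-1})` in `betaTerm`. -/
def betaCoefficient (q : ℝ) (ν N M n j : ℕ) (l : ℤ) (s : ℂ) : ℂ :=
  aCoeff s (s - ν) (2 * n) j * ((-1) ^ M * poch (s + j) (M - 1))
    * incBeta (q ^ N) (s + (-ν + j + qDelta q * l + M - 1)) (-j - M + 2 - s)

/-- Separates a numerator that is entire in `s` and independent of `l` from the Pochhammer factor,
the only source of poles. -/
theorem fourierTerm_eq (q : ℝ) (ν N M n : ℕ) (l : ℤ) (s : ℂ) :
    fourierTerm q s (s - ν) N M n l = ∑ j ∈ Finset.range (2 * n + 1), ∑ k ∈ Finset.Icc 1 (M - 1),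
      1 / (2 * Real.pi * Complex.I * l) ^ (2 * n) * (fourierCoefficient q ν N n j k s
        / poch (s + (-ν + j + qDelta q * l)) k) := by
  refine Finset.sum_congr rfl fun j _ => Finset.sum_congr rfl fun k _ => ?_
  rw [fourierCoefficient, show s - ν + (j + k - 1 : ℂ) = s - ν + j + k - 1 by ring,
    show s + (j - 1 + k : ℂ) = s + j - 1 + k by ring,
    show s + (-ν + j + qDelta q * l) = s - ν + j + qDelta q * l by ring]
  ring

/-- Here the numerator depends on `l`, but only through `incBeta`, and it is analytic for `Re s > ν
+ 1 - M`. -/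
theorem betaTerm_eq (q : ℝ) (ν N M n : ℕ) (l : ℤ) (s : ℂ) :
    betaTerm q s (s - ν) N M n l = ∑ j ∈ Finset.range (2 * n + 1),
      1 / (2 * Real.pi * Complex.I * l) ^ (2 * n) * (betaCoefficient q ν N M n j l s
        / poch (s + (-ν + j + qDelta q * l)) (M - 1)) := by
  refine Finset.sum_congr rfl fun j _ => ?_
  rw [betaCoefficient,
    show s + (-ν + j + qDelta q * l + M - 1) = s - ν + j + qDelta q * l + M - 1 by ring,
    show -j - M + 2 - s = -s - j - M + 2 by ring,
    show s + (-ν + j + qDelta q * l) = s - ν + j + qDelta q * l by ring]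
  ring

theorem differentiable_fourierCoefficient {q : ℝ} (hq0 : 0 < q) (hq1 : q < 1) {N : ℕ}
    (hN : 1 ≤ N) (ν n j k : ℕ) : Differentiable ℂ (fourierCoefficient q ν N n j k) := by
  unfold fourierCoefficient
  have h1 := differentiable_aCoeff ν (2 * n) j
  have h2 := differentiable_poch (k - 1)
  have h3 := differentiable_qPow hq0 hq1 hN ν N (j + k - 1) (j - 1 + k)
  fun_prop

theorem analyticAt_fourierCoefficient {q : ℝ} (hq0 : 0 < q) (hq1 : q < 1) {N : ℕ}
    (hN : 1 ≤ N) (ν n j k : ℕ) (s : ℂ) : AnalyticAt ℂ (fourierCoefficient q ν N n j k) s :=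
  (differentiable_fourierCoefficient hq0 hq1 hN ν n j k).analyticAt s

theorem betaArgument_re (q : ℝ) (ν j M : ℕ) (l : ℤ) (s : ℂ) :
    (s + (-ν + j + qDelta q * l + M - 1)).re = s.re - ν + j + M - 1 := by
  simp only [add_re, sub_re, neg_re, natCast_re, one_re, qDelta_mul_re]
  ring

theorem analyticAt_betaCoefficient {q : ℝ} (hq0 : 0 < q) (hq1 : q < 1) {N : ℕ}
    (hN : 1 ≤ N) {ν M : ℕ} (n j : ℕ) (l : ℤ) {s : ℂ} (hs : (ν : ℝ) + 1 - M < s.re) :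
    AnalyticAt ℂ (betaCoefficient q ν N M n j l) s := by
  refine (AnalyticAt.mul ((differentiable_aCoeff ν (2 * n) j).analyticAt s) ?_).mul
    (analyticAt_incBeta (pow_pos hq0 N) (pow_lt_one₀ hq0.le hq1 (by omega)) _ _ ?_)
  · have h2 := differentiable_poch (M - 1)
    exact Differentiable.analyticAt (f := fun s : ℂ => (-1 : ℂ) ^ M * poch (s + j) (M - 1))
      (by fun_prop) s
  · rw [betaArgument_re]
    have : (0 : ℝ) ≤ j := by positivity
    linarith

theorem analyticAt_poch_add (c : ℂ) (k : ℕ) (s : ℂ) : AnalyticAt ℂ (fun s => poch (s + c) k) s := by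
  have h := differentiable_poch k
  exact Differentiable.analyticAt (f := fun s : ℂ => poch (s + c) k) (by fun_prop) s

theorem analyticAt_fourierTerm {q : ℝ} (hq0 : 0 < q) (hq1 : q < 1) {N : ℕ} (hN : 1 ≤ N)
    {ν : ℕ} (M n : ℕ) {l : ℤ} {s : ℂ} (hs : ∀ i : ℕ, s + (-ν + qDelta q * l) + i ≠ 0) :
    AnalyticAt ℂ (fun s => fourierTerm q s (s - ν) N M n l) s := by
  simp_rw [fourierTerm_eq]
  refine Finset.analyticAt_fun_sum _ fun j _ => Finset.analyticAt_fun_sum _ fun k _ => ?_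
  refine analyticAt_const.mul ((analyticAt_fourierCoefficient hq0 hq1 hN ν n j k s).div
    (analyticAt_poch_add _ k s) (poch_ne_zero fun i _ => ?_))
  convert! hs (j + i) using 1
  push_cast
  ring

theorem analyticAt_betaTerm {q : ℝ} (hq0 : 0 < q) (hq1 : q < 1) {N : ℕ} (hN : 1 ≤ N)
    {ν M : ℕ} (n : ℕ) {l : ℤ} {s : ℂ} (hM : (ν : ℝ) + 1 - M < s.re)
    (hs : ∀ i : ℕ, s + (-ν + qDelta q * l) + i ≠ 0) :
    AnalyticAt ℂ (fun s => betaTerm q s (s - ν) N M n l) s := by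
  simp_rw [betaTerm_eq]
  refine Finset.analyticAt_fun_sum _ fun j _ => ?_
  refine analyticAt_const.mul ((analyticAt_betaCoefficient hq0 hq1 hN n j l hM).div
    (analyticAt_poch_add _ _ s) (poch_ne_zero fun i _ => ?_))
  convert! hs (j + i) using 1
  push_cast
  ring

theorem meromorphicAt_fourierTerm {q : ℝ} (hq0 : 0 < q) (hq1 : q < 1) {N : ℕ} (hN : 1 ≤ N)
    (ν M n : ℕ) (l : ℤ) (s : ℂ) :
    MeromorphicAt (fun s => fourierTerm q s (s - ν) N M n l) s := by
  simp_rw [fourierTerm_eq]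
  refine MeromorphicAt.fun_sum fun j _ => MeromorphicAt.fun_sum fun k _ => ?_
  exact (MeromorphicAt.const _ s).mul
    ((analyticAt_fourierCoefficient hq0 hq1 hN ν n j k s).meromorphicAt.div
      (analyticAt_poch_add _ k s).meromorphicAt)

theorem meromorphicAt_betaTerm {q : ℝ} (hq0 : 0 < q) (hq1 : q < 1) {N : ℕ} (hN : 1 ≤ N)
    {ν M : ℕ} (n : ℕ) (l : ℤ) {s : ℂ} (hM : (ν : ℝ) + 1 - M < s.re) :
    MeromorphicAt (fun s => betaTerm q s (s - ν) N M n l) s := by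
  simp_rw [betaTerm_eq]
  refine MeromorphicAt.fun_sum fun j _ => ?_
  exact (MeromorphicAt.const _ s).mul
    ((analyticAt_betaCoefficient hq0 hq1 hN n j l hM).meromorphicAt.div
      (analyticAt_poch_add _ _ s).meromorphicAt)

/-! ### Locally uniform convergence and meromorphy of the series over `l`. -/

/-- `δ` is a nonzero purely imaginary number, so `δl` leaves every horizontal strip. For all but
finitely many `l`, every Pochhammer denominator then has modulus at least one. -/
theorem eventually_one_le_abs_im {q : ℝ} (hq0 : 0 < q) (hq1 : q < 1) (R : ℝ) :
    ∀ᶠ l : ℤ in cofinite, ∀ s : ℂ, |s.im| ≤ R → 1 ≤ |(s + qDelta q * l).im| := by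
  have hlog := Real.log_neg hq0 hq1
  have him : ∀ l : ℤ, (qDelta q * l).im = 2 * Real.pi / Real.log q * l := by
    intro l
    have e : qDelta q * l = ((2 * Real.pi / Real.log q * l : ℝ) : ℂ) * Complex.I := by
      rw [qDelta]
      push_cast
      ring
    rw [e]
    simp
  have hD : 0 < |2 * Real.pi / Real.log q| := abs_pos.2 (div_ne_zero (by positivity) hlog.ne)
  have ht : Tendsto (fun l : ℤ => ‖(l : ℝ)‖) cofinite atTop :=
    tendsto_norm_cocompact_atTop.comp Int.tendsto_coe_cofinite
  filter_upwards [ht.eventually_ge_atTop ((R + 1) / |2 * Real.pi / Real.log q|)] with l hl s hs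
  rw [div_le_iff₀ hD, Real.norm_eq_abs, ← abs_mul, mul_comm, ← him] at hl
  have h := abs_sub_abs_le_abs_sub (qDelta q * l).im (-s.im)
  rw [abs_neg, sub_neg_eq_add, add_comm, ← add_im] at h
  linarith

theorem one_le_norm_poch {z : ℂ} (hz : 1 ≤ |z.im|) (k : ℕ) : 1 ≤ ‖poch z k‖ := by
  induction k with
  | zero => simp [poch_zero]
  | succ k ih =>
    rw [poch_succ, norm_mul]
    refine one_le_mul_of_one_le_of_one_le ih (hz.trans ?_)
    simpa using Complex.abs_im_le_norm (z + k)

theorem norm_mul_div_poch_le {a b z : ℂ} {C : ℝ} (hb : ‖b‖ ≤ C) (hz : 1 ≤ |z.im|) (k : ℕ) :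
    ‖a * (b / poch z k)‖ ≤ ‖a‖ * C := by
  rw [norm_mul, norm_div]
  exact mul_le_mul_of_nonneg_left ((div_le_self (norm_nonneg _) (one_le_norm_poch hz k)).trans hb)
    (norm_nonneg _)

theorem fourierTerm_bound {q : ℝ} (hq0 : 0 < q) (hq1 : q < 1) {N : ℕ} (hN : 1 ≤ N) (ν M n : ℕ)
    {K : Set ℂ} (hK : IsCompact K) :
    ∃ C, ∀ l : ℤ, ∀ s ∈ K, 1 ≤ |(s + qDelta q * l).im| →
      ‖fourierTerm q s (s - ν) N M n l‖
        ≤ ‖1 / (2 * Real.pi * Complex.I * l) ^ (2 * n)‖ * C := by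
  choose C hC using fun j k : ℕ => hK.exists_bound_of_continuousOn
    (differentiable_fourierCoefficient hq0 hq1 hN ν n j k).continuous.continuousOn
  refine ⟨∑ j ∈ Finset.range (2 * n + 1), ∑ k ∈ Finset.Icc 1 (M - 1), C j k, ?_⟩
  intro l s hs him
  rw [fourierTerm_eq, Finset.mul_sum]
  refine (norm_sum_le _ _).trans (Finset.sum_le_sum fun j _ => ?_)
  rw [Finset.mul_sum]
  refine (norm_sum_le _ _).trans (Finset.sum_le_sum fun k _ => ?_)
  refine norm_mul_div_poch_le (hC j k s hs) ?_ k
  convert! him using 2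
  simp

/-- The margin `ε` keeps the first beta parameter at real part at least `ε` throughout `K`, so one
majorant serves for all `l`. -/
theorem betaTerm_bound {q : ℝ} (hq0 : 0 < q) (hq1 : q < 1) {N : ℕ} (hN : 1 ≤ N) {ν M : ℕ} (n : ℕ)
    {ε : ℝ} (hε : 0 < ε) {K : Set ℂ} (hK : IsCompact K)
    (hKε : ∀ s ∈ K, (ν : ℝ) + 1 - M + ε ≤ s.re) :
    ∃ C, ∀ l : ℤ, ∀ s ∈ K, 1 ≤ |(s + qDelta q * l).im| →
      ‖betaTerm q s (s - ν) N M n l‖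
        ≤ ‖1 / (2 * Real.pi * Complex.I * l) ^ (2 * n)‖ * C := by
  have hA : ∀ j : ℕ, ∃ A, ∀ s ∈ K,
      ‖aCoeff s (s - ν) (2 * n) j * ((-1) ^ M * poch (s + j) (M - 1))‖ ≤ A := by
    intro j
    have h1 := (differentiable_aCoeff ν (2 * n) j).continuous
    have h2 := (differentiable_poch (M - 1)).continuous
    exact hK.exists_bound_of_continuousOn (Continuous.continuousOn (by fun_prop))
  have hB : ∀ j : ℕ, ∃ B, ∀ s ∈ K, ‖(-j - M + 2 - s).re - 1‖ ≤ B := fun j =>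
    hK.exists_bound_of_continuousOn (Continuous.continuousOn (by fun_prop))
  choose A hA using hA
  choose B hB using hB
  have hx0 := pow_pos hq0 N
  have hx1 : q ^ N < 1 := pow_lt_one₀ hq0.le hq1 (by omega)
  refine ⟨∑ j ∈ Finset.range (2 * n + 1),
    A j * ((1 - q ^ N) ^ (-|B j|) * ∫ u in (0 : ℝ)..(q ^ N), u ^ (ε - 1)), ?_⟩
  intro l s hs him
  rw [betaTerm_eq, Finset.mul_sum]
  refine (norm_sum_le _ _).trans (Finset.sum_le_sum fun j _ => ?_)
  refine norm_mul_div_poch_le ?_ ?_ _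
  · rw [betaCoefficient, norm_mul]
    refine mul_le_mul (hA j s hs) (norm_incBeta_le_of_le hx0 hx1 hε ?_ (abs_nonneg _) ?_)
      (norm_nonneg _) ((norm_nonneg _).trans (hA j s hs))
    · rw [betaArgument_re]
      have h1 := hKε s hs
      have : (0 : ℝ) ≤ j := by positivity
      linarith
    · exact neg_le_of_abs_le ((hB j s hs).trans (le_abs_self _))
  · convert! him using 2
    simp

theorem abs_im_le_of_mem_closedBall {s s₀ : ℂ} {ρ : ℝ} (hs : s ∈ Metric.closedBall s₀ ρ) :
    |s.im| ≤ |s₀.im| + ρ := by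
  have h1 : |(s - s₀).im| ≤ ρ :=
    (Complex.abs_im_le_norm _).trans (by rwa [← dist_eq_norm])
  rw [sub_im] at h1
  have := abs_sub_abs_le_abs_sub s.im s₀.im
  linarith

theorem re_le_of_mem_closedBall {s s₀ : ℂ} {ρ : ℝ} (hs : s ∈ Metric.closedBall s₀ ρ) :
    s₀.re - ρ ≤ s.re := by
  have h1 : |(s - s₀).re| ≤ ρ :=
    (Complex.abs_re_le_norm _).trans (by rwa [← dist_eq_norm])
  rw [sub_re] at h1
  linarith [(abs_le.1 h1).1]

theorem fourierTerm_zero (q : ℝ) (s t : ℂ) (N M : ℕ) {n : ℕ} (hn : 1 ≤ n) :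
    fourierTerm q s t N M n 0 = 0 := by
  have : 2 * n ≠ 0 := by omega
  simp [fourierTerm, this]

theorem betaTerm_zero (q : ℝ) (s t : ℂ) (N M : ℕ) {n : ℕ} (hn : 1 ≤ n) :
    betaTerm q s t N M n 0 = 0 := by
  have : 2 * n ≠ 0 := by omega
  simp [betaTerm, this]

theorem summable_fourierTerm {q : ℝ} (hq0 : 0 < q) (hq1 : q < 1) {N : ℕ} (hN : 1 ≤ N) (ν M : ℕ)
    {n : ℕ} (hn : 1 ≤ n) (s : ℂ) : Summable fun l : ℤ => fourierTerm q s (s - ν) N M n l := by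
  obtain ⟨C, hC⟩ := fourierTerm_bound hq0 hq1 hN ν M n (isCompact_singleton (x := s))
  refine Summable.of_norm_bounded_eventually
    ((summable_norm_one_div_two_pi_pow (k := 2 * n) (by omega)).mul_right C) ?_
  filter_upwards [eventually_one_le_abs_im hq0 hq1 |s.im|] with l hl
  exact hC l s rfl (hl s le_rfl)

theorem summable_betaTerm {q : ℝ} (hq0 : 0 < q) (hq1 : q < 1) {N : ℕ} (hN : 1 ≤ N) {ν M : ℕ}
    {n : ℕ} (hn : 1 ≤ n) {s : ℂ} (hs : (ν : ℝ) + 1 - M < s.re) :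
    Summable fun l : ℤ => betaTerm q s (s - ν) N M n l := by
  obtain ⟨C, hC⟩ := betaTerm_bound (ν := ν) (M := M) hq0 hq1 hN n (sub_pos.2 hs)
    (isCompact_singleton (x := s))
    (fun s' hs' => by rw [Set.mem_singleton_iff.1 hs', add_sub_cancel])
  refine Summable.of_norm_bounded_eventually
    ((summable_norm_one_div_two_pi_pow (k := 2 * n) (by omega)).mul_right C) ?_
  filter_upwards [eventually_one_le_abs_im hq0 hq1 |s.im|] with l hl
  exact hC l s rfl (hl s le_rfl)

/-- The series over `l` of the sums `fourierTerm + betaTerm`, as a function of `s`. -/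
def fourierSeries (q : ℝ) (ν N M n : ℕ) (s : ℂ) : ℂ :=
  ∑' l : ℤ, (fourierTerm q s (s - ν) N M n l + betaTerm q s (s - ν) N M n l)

/-- On a small ball only the finitely many `l` in `S` can have poles. The other terms are analytic
and dominated by a multiple of `|2πl|^{-2n}`, so their sum is analytic by the Weierstrass test. -/
theorem exists_fourierSeries_eq_sum_add {q : ℝ} (hq0 : 0 < q) (hq1 : q < 1) {N : ℕ} (hN : 1 ≤ N)
    {ν M n : ℕ} (hn : 1 ≤ n) {s₀ : ℂ} (hs : (ν : ℝ) + 1 - M < s₀.re) :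
    ∃ (S : Finset ℤ) (g : ℂ → ℂ), AnalyticAt ℂ g s₀ ∧
      (fun s => ∑ l ∈ S, (fourierTerm q s (s - ν) N M n l + betaTerm q s (s - ν) N M n l) + g s)
        =ᶠ[𝓝 s₀] fourierSeries q ν N M n := by
  set ρ := (s₀.re - ((ν : ℝ) + 1 - M)) / 2 with hρ_def
  have hρ : 0 < ρ := by
    rw [hρ_def]
    linarith
  have hre : ∀ s ∈ Metric.closedBall s₀ ρ, (ν : ℝ) + 1 - M + ρ ≤ s.re := by
    intro s hs'
    have := re_le_of_mem_closedBall hs'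
    linarith
  obtain ⟨C₁, hC₁⟩ := fourierTerm_bound hq0 hq1 hN ν M n (isCompact_closedBall s₀ ρ)
  obtain ⟨C₂, hC₂⟩ := betaTerm_bound hq0 hq1 hN n hρ (isCompact_closedBall s₀ ρ) hre
  have hev := eventually_one_le_abs_im hq0 hq1 (|s₀.im| + ρ)
  rw [Filter.eventually_cofinite] at hev
  set S := hev.toFinset with hS_def
  have hS : ∀ l : ℤ, l ∉ S → ∀ s ∈ Metric.closedBall s₀ ρ, 1 ≤ |(s + qDelta q * l).im| := by
    intro l hl s hs'
    rw [hS_def, Set.Finite.mem_toFinset, Set.mem_ofPred_eq, not_not] at hl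
    exact hl s (abs_im_le_of_mem_closedBall hs')
  have hball := Metric.ball_subset_closedBall (x := s₀) (ε := ρ)
  refine ⟨S, fun s => ∑' l : {l : ℤ // l ∉ S},
    (fourierTerm q s (s - ν) N M n l + betaTerm q s (s - ν) N M n l), ?_, ?_⟩
  · refine DifferentiableOn.analyticAt (s := Metric.ball s₀ ρ) ?_ (Metric.ball_mem_nhds _ hρ)
    refine differentiableOn_tsum_of_summable_norm
      (u := fun l : {l : ℤ // l ∉ S} =>
        ‖(1 : ℂ) / (2 * Real.pi * Complex.I * (l : ℤ)) ^ (2 * n)‖ * (C₁ + C₂)) ?_ ?_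
      Metric.isOpen_ball ?_
    · exact ((summable_norm_one_div_two_pi_pow (k := 2 * n) (by omega)).mul_right
        (C₁ + C₂)).subtype _
    · intro l s hs'
      have him := hS l l.2 s (hball hs')
      have hne : ∀ i : ℕ, s + (-ν + qDelta q * (l : ℤ)) + i ≠ 0 := by
        intro i h
        have h0 := congrArg Complex.im h
        simp only [add_im, neg_im, natCast_im, zero_im, add_zero, neg_zero, zero_add] at h0 him
        rw [h0] at him
        norm_num at him
      refine ((analyticAt_fourierTerm hq0 hq1 hN M n hne).add
        (analyticAt_betaTerm hq0 hq1 hN n ?_ hne)).differentiableAt.differentiableWithinAt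
      linarith [hre s (hball hs')]
    · intro l s hs'
      have him := hS l l.2 s (hball hs')
      rw [mul_add]
      exact (norm_add_le _ _).trans
        (add_le_add (hC₁ l s (hball hs') him) (hC₂ l s (hball hs') him))
  · filter_upwards [Metric.ball_mem_nhds s₀ hρ] with s hs'
    have hsum := (summable_fourierTerm hq0 hq1 hN ν M hn s).add
      (summable_betaTerm hq0 hq1 hN hn (s := s) (M := M) (ν := ν)
        (by linarith [hre s (hball hs')]))
    rw [fourierSeries, ← hsum.sum_add_tsum_subtype_compl S]

theorem meromorphicAt_fourierSeries {q : ℝ} (hq0 : 0 < q) (hq1 : q < 1) {N : ℕ} (hN : 1 ≤ N)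
    {ν M n : ℕ} (hn : 1 ≤ n) {s : ℂ} (hs : (ν : ℝ) + 1 - M < s.re) :
    MeromorphicAt (fourierSeries q ν N M n) s := by
  obtain ⟨S, g, hg, heq⟩ := exists_fourierSeries_eq_sum_add hq0 hq1 hN hn hs
  refine MeromorphicAt.congr ?_ (heq.filter_mono nhdsWithin_le_nhds)
  refine MeromorphicAt.add (MeromorphicAt.fun_sum fun l _ => ?_) hg.meromorphicAt
  exact (meromorphicAt_fourierTerm hq0 hq1 hN ν M n l s).add
    (meromorphicAt_betaTerm hq0 hq1 hN n l hs)

theorem analyticAt_fourierSeries {q : ℝ} (hq0 : 0 < q) (hq1 : q < 1) {N : ℕ} (hN : 1 ≤ N)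
    {ν M n : ℕ} (hn : 1 ≤ n) {s : ℂ} (hs : (ν : ℝ) + 1 - M < s.re) (hp : s ∉ qZetaPoles q ν) :
    AnalyticAt ℂ (fourierSeries q ν N M n) s := by
  obtain ⟨S, g, hg, heq⟩ := exists_fourierSeries_eq_sum_add hq0 hq1 hN hn hs
  refine AnalyticAt.congr ?_ heq
  refine AnalyticAt.add (Finset.analyticAt_fun_sum _ fun l _ => ?_) hg
  -- For `l = 0` the Pochhammer denominators may vanish outside `qZetaPoles`; the term is
  -- nevertheless zero by the convention `1 / 0 = 0`.
  by_cases hl : l = 0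
  · subst hl
    simp only [fourierTerm_zero q _ _ N M hn, betaTerm_zero q _ _ N M hn]
    exact analyticAt_const
  · have hne : ∀ i : ℕ, s + (-ν + qDelta q * l) + i ≠ 0 := by
      intro i h
      refine hp ⟨i, -l, Or.inl (neg_ne_zero.2 hl), ?_⟩
      push_cast
      linear_combination h
    exact (analyticAt_fourierTerm hq0 hq1 hN M n hne).add (analyticAt_betaTerm hq0 hq1 hN n hs hne)

theorem elementaryPart_poch_ne_zero {q : ℝ} {ν : ℕ} {s : ℂ} (hp : s ∉ qZetaPoles q ν) {r : ℕ}
    (hr : r < ν) : poch (-s + 1) (r + 1) ≠ 0 := by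
  -- A vanishing factor means `s = 1 + i = ν - (ν - 1 - i)`.
  refine poch_ne_zero fun i hi h => hp ⟨ν - 1 - i, 0, Or.inr (by omega), ?_⟩
  rw [Nat.sub_sub, Nat.cast_sub (by omega)]
  push_cast
  linear_combination -h

/-! ### The elementary part and the complete formula as functions of `s`. -/

/-- Isolates the denominators `(-s+1)_{r+1}`; everything else is entire, so meromorphy everywhere
and analyticity off the poles follow from one decomposition. -/
theorem exists_qElementaryPart_eq_add_sum {q : ℝ} (hq0 : 0 < q) (hq1 : q < 1) {N : ℕ}
    (hN : 1 ≤ N) (ν n : ℕ) :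
    ∃ f : ℂ → ℂ, ∃ g : ℕ → ℂ → ℂ, Differentiable ℂ f ∧ (∀ r, Differentiable ℂ (g r)) ∧
      ∀ s, qElementaryPart s ν q N n
        = f s + ∑ r ∈ Finset.range ν, g r s / poch (-s + 1) (r + 1) := by
  have h1 : (q : ℂ) ≠ 0 := by exact_mod_cast hq0.ne'
  have h2 : ∀ m : ℕ, 1 ≤ m → ((1 - q ^ m : ℝ) : ℂ) ≠ 0 := by
    intro m hm
    have : 1 - q ^ m ≠ 0 := (sub_pos.2 (pow_lt_one₀ hq0.le hq1 (by omega))).ne'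
    exact_mod_cast this
  have dq : ∀ a b : ℂ, Differentiable ℂ fun s => (q : ℂ) ^ (a * (s - ν + b)) := fun a b s =>
    DifferentiableAt.const_cpow (by fun_prop) (Or.inl h1)
  have dq' : ∀ a : ℂ, Differentiable ℂ fun s => (q : ℂ) ^ (a * (s - ν)) := fun a s =>
    DifferentiableAt.const_cpow (by fun_prop) (Or.inl h1)
  have d1 : ∀ m : ℕ, 1 ≤ m → ∀ b : ℂ, Differentiable ℂ
      fun s : ℂ => ((1 - q ^ m : ℝ) : ℂ) ^ (-s + b) := fun m hm b s =>
    DifferentiableAt.const_cpow (by fun_prop) (Or.inl (h2 m hm))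
  have d2 : ∀ m : ℕ, 1 ≤ m → Differentiable ℂ
      fun s : ℂ => ((1 - q ^ m : ℝ) : ℂ) ^ (-s) := fun m hm s =>
    DifferentiableAt.const_cpow (by fun_prop) (Or.inl (h2 m hm))
  refine ⟨fun s => (∑ m ∈ Finset.Icc 1 N,
      (q : ℂ) ^ ((m : ℂ) * (s - ν)) * ((1 - q ^ m : ℝ) : ℂ) ^ (-s))
    - 1 / 2 * (q : ℂ) ^ ((N : ℂ) * (s - ν)) * ((1 - q ^ N : ℝ) : ℂ) ^ (-s)
    - ∑ k ∈ Finset.Icc 1 n, ∑ j ∈ Finset.range (2 * k),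
        ((bernoulli (2 * k) : ℚ) : ℂ) / ((2 * k).factorial : ℂ)
          * (Real.log q : ℂ) ^ (2 * k - 1) * aCoeff s (s - ν) (2 * k - 1) j
          * (q : ℂ) ^ ((N : ℂ) * (s - ν + j)) * ((1 - q ^ N : ℝ) : ℂ) ^ (-s + -(j : ℂ)),
    fun r s => 1 / (Real.log q : ℂ) * (poch (-(ν : ℂ) + 1) r * (q : ℂ) ^ ((N : ℂ) * (s - ν))
      * ((1 - q ^ N : ℝ) : ℂ) ^ (-s + (1 + r))), ?_, ?_, ?_⟩
  · refine Differentiable.sub (Differentiable.sub (Differentiable.fun_sum fun m hm => ?_) ?_)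
      (Differentiable.fun_sum fun k _ => Differentiable.fun_sum fun j _ => ?_)
    · exact (dq' m).mul (d2 m (Finset.mem_Icc.1 hm).1)
    · exact ((dq' N).const_mul _).mul (d2 N hN)
    · exact (((differentiable_aCoeff ν (2 * k - 1) j).const_mul _).mul (dq N j)).mul (d1 N hN (-(j : ℂ)))
  · intro r
    exact (((dq' N).const_mul _).mul (d1 N hN _)).const_mul _
  · intro s
    have e : ∑ r ∈ Finset.range ν, 1 / (Real.log q : ℂ) * (poch (-(ν : ℂ) + 1) r
        * (q : ℂ) ^ ((N : ℂ) * (s - ν)) * ((1 - q ^ N : ℝ) : ℂ) ^ (-s + (1 + r)))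
          / poch (-s + 1) (r + 1)
        = 1 / (Real.log q : ℂ) * ∑ r ∈ Finset.range ν,
        poch (-(ν : ℂ) + 1) r / poch (-s + 1) (r + 1)
          * (q : ℂ) ^ ((N : ℂ) * (s - ν)) * ((1 - q ^ N : ℝ) : ℂ) ^ (-s + 1 + r) := by
      rw [Finset.mul_sum]
      refine Finset.sum_congr rfl fun r _ => ?_
      rw [show -s + (1 + r : ℂ) = -s + 1 + r by ring]
      ring
    rw [e, qElementaryPart]
    simp only [← sub_eq_add_neg (-s)]
    ring

theorem meromorphicAt_qElementaryPart {q : ℝ} (hq0 : 0 < q) (hq1 : q < 1) {N : ℕ}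
    (hN : 1 ≤ N) (ν n : ℕ) (s : ℂ) : MeromorphicAt (fun s => qElementaryPart s ν q N n) s := by
  obtain ⟨f, g, hf, hg, h⟩ := exists_qElementaryPart_eq_add_sum hq0 hq1 hN ν n
  simp_rw [h]
  have hp := fun k => differentiable_poch k
  refine (hf.analyticAt s).meromorphicAt.add (MeromorphicAt.fun_sum fun r _ => ?_)
  exact ((hg r).analyticAt s).meromorphicAt.div
    (Differentiable.analyticAt (f := fun s : ℂ => poch (-s + 1) (r + 1))
      (by have := hp (r + 1); fun_prop) s).meromorphicAt

theorem analyticAt_qElementaryPart {q : ℝ} (hq0 : 0 < q) (hq1 : q < 1) {N : ℕ}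
    (hN : 1 ≤ N) {ν : ℕ} (n : ℕ) {s : ℂ} (hp : s ∉ qZetaPoles q ν) :
    AnalyticAt ℂ (fun s => qElementaryPart s ν q N n) s := by
  obtain ⟨f, g, hf, hg, h⟩ := exists_qElementaryPart_eq_add_sum hq0 hq1 hN ν n
  simp_rw [h]
  refine (hf.analyticAt s).add (Finset.analyticAt_fun_sum _ fun r hr => ?_)
  exact ((hg r).analyticAt s).div
    (Differentiable.analyticAt (f := fun s : ℂ => poch (-s + 1) (r + 1))
      (by have := differentiable_poch (r + 1); fun_prop) s)
    (elementaryPart_poch_ne_zero hp (Finset.mem_range.1 hr))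

/-- The right-hand side of the approximate formula, with both series over all integers. -/
def qZetaFormula (q : ℝ) (ν N M n : ℕ) (s : ℂ) : ℂ :=
  ((1 - q : ℝ) : ℂ) ^ s * (qElementaryPart s ν q N n
    + (Real.log q : ℂ) ^ (2 * n - 1) * fourierSeries q ν N M n s)

theorem analyticAt_one_sub_cpow {q : ℝ} (hq1 : q < 1) (s : ℂ) :
    AnalyticAt ℂ (fun s => ((1 - q : ℝ) : ℂ) ^ s) s := by
  have h : ((1 - q : ℝ) : ℂ) ≠ 0 := by exact_mod_cast (sub_pos.2 hq1).ne'
  exact Differentiable.analyticAt (fun s => differentiableAt_id.const_cpow (Or.inl h)) s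

theorem meromorphicAt_qZetaFormula {q : ℝ} (hq0 : 0 < q) (hq1 : q < 1) {N : ℕ} (hN : 1 ≤ N)
    {ν M n : ℕ} (hn : 1 ≤ n) {s : ℂ} (hs : (ν : ℝ) + 1 - M < s.re) :
    MeromorphicAt (qZetaFormula q ν N M n) s :=
  (analyticAt_one_sub_cpow hq1 s).meromorphicAt.mul
    ((meromorphicAt_qElementaryPart hq0 hq1 hN ν n s).add
      ((MeromorphicAt.const _ s).mul (meromorphicAt_fourierSeries hq0 hq1 hN hn hs)))

theorem analyticAt_qZetaFormula {q : ℝ} (hq0 : 0 < q) (hq1 : q < 1) {N : ℕ} (hN : 1 ≤ N)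
    {ν M n : ℕ} (hn : 1 ≤ n) {s : ℂ} (hs : (ν : ℝ) + 1 - M < s.re) (hp : s ∉ qZetaPoles q ν) :
    AnalyticAt ℂ (qZetaFormula q ν N M n) s :=
  (analyticAt_one_sub_cpow hq1 s).mul
    ((analyticAt_qElementaryPart hq0 hq1 hN n hp).add
      (analyticAt_const.mul (analyticAt_fourierSeries hq0 hq1 hN hn hs hp)))

/-! ### The identity theorem and the existence of the continuation. -/

/-- The difference has infinite order at a point far to the right, and infinite order propagates
over the connected half-plane. -/
theorem MeromorphicOn.eventuallyEq_nhdsNE_of_re {f g : ℂ → ℂ} {c d : ℝ}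
    (hf : ∀ s : ℂ, c < s.re → MeromorphicAt f s) (hg : ∀ s : ℂ, c < s.re → MeromorphicAt g s)
    (hfg : ∀ s : ℂ, d < s.re → f s = g s) {s : ℂ} (hs : c < s.re) : f =ᶠ[𝓝[≠] s] g := by
  have hU : IsPreconnected {s : ℂ | c < s.re} := (convex_halfSpace_re_gt c).isPreconnected
  have hm : MeromorphicOn (fun s => f s - g s) {s : ℂ | c < s.re} := fun s hs =>
    (hf s hs).fun_sub (hg s hs)
  set y : ℂ := ((max c d + 1 : ℝ) : ℂ) with hy
  have hyre : y.re = max c d + 1 := Complex.ofReal_re _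
  have hyc : c < y.re := by rw [hyre]; linarith [le_max_left c d]
  have hyd : d < y.re := by rw [hyre]; linarith [le_max_right c d]
  have htop : meromorphicOrderAt (fun s => f s - g s) y = ⊤ := by
    rw [meromorphicOrderAt_eq_top_iff]
    refine eventually_nhdsWithin_of_eventually_nhds ?_
    filter_upwards [(isOpen_lt continuous_const Complex.continuous_re).mem_nhds hyd] with z hz
    rw [hfg z hz, sub_self]
  have htop' : meromorphicOrderAt (fun s => f s - g s) s = ⊤ := by
    by_contra h
    exact hm.meromorphicOrderAt_ne_top_of_isPreconnected hU hs hyc h htop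
  rw [meromorphicOrderAt_eq_top_iff] at htop'
  filter_upwards [htop'] with z hz
  exact sub_eq_zero.1 hz

/-- Analytic functions are in normal form, and normal forms that agree on a punctured neighbourhood
also agree at its centre. -/
theorem eq_of_meromorphicNFAt_of_analyticAt {f g : ℂ → ℂ} {s : ℂ} (hf : MeromorphicNFAt f s)
    (hg : AnalyticAt ℂ g s) (h : f =ᶠ[𝓝[≠] s] g) : f s = g s :=
  ((hf.eventuallyEq_nhdsNE_iff_eventuallyEq_nhds hg.meromorphicNFAt).1 h).eq_of_nhds

theorem notMem_qZetaPoles {q : ℝ} {ν : ℕ} {s : ℂ} (hs : ∀ m : ℕ, s.re ≠ (ν : ℝ) - m) :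
    s ∉ qZetaPoles q ν := by
  rintro ⟨r, l, -, rfl⟩
  apply hs r
  rw [add_re, qDelta_mul_re, sub_re, natCast_re, natCast_re, add_zero]

theorem notMem_qZetaPoles_of_lt_re {q : ℝ} {ν : ℕ} {s : ℂ} (hs : (ν : ℝ) < s.re) :
    s ∉ qZetaPoles q ν := by
  refine notMem_qZetaPoles fun m h => ?_
  have : (0 : ℝ) ≤ m := by positivity
  linarith

theorem qZetaFormula_eq_qSeries {q : ℝ} (hq0 : 0 < q) (hq1 : q < 1) {ν : ℕ} (hν : 1 ≤ ν)
    {N M n : ℕ} (hN : 1 ≤ N) (hM : 1 ≤ M) (hn : 1 ≤ n) {s : ℂ} (hs : (ν : ℝ) < s.re) :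
    qZetaFormula q ν N M n s = qSeries q s (s - ν) :=
  (qSeries_eq_of_lt_re hq0 hq1 hν hN hM hn hs).symm

/-- Glues the formulas with `N = n = 1` and growing `M`, using at each point `s` a value `M = μ s`
whose half-plane contains `s`. -/
theorem exists_isQZeta {q : ℝ} (hq0 : 0 < q) (hq1 : q < 1) {ν : ℕ} (hν : 1 ≤ ν) :
    ∃ Z, IsQZeta q ν Z := by
  set G : ℕ → ℂ → ℂ := fun M => qZetaFormula q ν 1 M 1
  -- The summand `3` leaves room: the half-plane of `μ s` contains every point within distance `1`
  -- of `s`.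
  set μ : ℂ → ℕ := fun s => ⌈|s.re|⌉₊ + ν + 3 with hμ_def
  set Z₀ : ℂ → ℂ := fun s => G (μ s) s
  have hμ : ∀ s : ℂ, (ν : ℝ) + 1 - μ s ≤ -2 - |s.re| := by
    intro s
    have := Nat.le_ceil |s.re|
    simp only [hμ_def]
    push_cast
    linarith
  have hμ' : ∀ s : ℂ, (ν : ℝ) + 1 - μ s < s.re := fun s => by
    linarith [hμ s, neg_abs_le s.re]
  have hG : ∀ M : ℕ, ∀ s : ℂ, (ν : ℝ) + 1 - M < s.re → MeromorphicAt (G M) s := fun M s hs =>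
    meromorphicAt_qZetaFormula hq0 hq1 le_rfl le_rfl hs
  have hGS : ∀ M : ℕ, 1 ≤ M → ∀ s : ℂ, (ν : ℝ) < s.re → G M s = qSeries q s (s - ν) :=
    fun M hM s hs => qZetaFormula_eq_qSeries hq0 hq1 hν le_rfl hM le_rfl hs
  have hμ1 : ∀ s, 1 ≤ μ s := fun s => by
    simp only [hμ_def]
    omega
  have hGG : ∀ M M' : ℕ, 1 ≤ M → 1 ≤ M' → ∀ s : ℂ, (ν : ℝ) + 1 - M < s.re →
      (ν : ℝ) + 1 - M' < s.re → G M =ᶠ[𝓝[≠] s] G M' := by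
    intro M M' hM hM' s hs hs'
    exact MeromorphicOn.eventuallyEq_nhdsNE_of_re
      (c := max ((ν : ℝ) + 1 - M) ((ν : ℝ) + 1 - M')) (d := ν)
      (fun s hs => hG M s ((le_max_left _ _).trans_lt hs))
      (fun s hs => hG M' s ((le_max_right _ _).trans_lt hs))
      (fun s hs => (hGS M hM s hs).trans (hGS M' hM' s hs).symm) (max_lt hs hs')
  have hloc : ∀ s₀, Z₀ =ᶠ[𝓝[≠] s₀] G (μ s₀) := by
    intro s₀
    -- On the unit ball about `s₀` the function `μ` takes values only in this finite range, so
    -- finitely many agreements with `G (μ s₀)` near `s₀` suffice.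
    have hfin : ∀ᶠ s in 𝓝[≠] s₀, ∀ M ∈ Finset.range (⌈|s₀.re| + 1⌉₊ + ν + 4),
        1 ≤ M ∧ (ν : ℝ) + 1 - M < s₀.re → G M s = G (μ s₀) s := by
      rw [Filter.eventually_all_finset]
      intro M _
      by_cases h : 1 ≤ M ∧ (ν : ℝ) + 1 - M < s₀.re
      · filter_upwards [hGG M (μ s₀) h.1 (hμ1 s₀) s₀ h.2 (hμ' s₀)] with s hs _ using hs
      · exact Eventually.of_forall fun s h' => absurd h' h
    filter_upwards [hfin, nhdsWithin_le_nhds (Metric.ball_mem_nhds s₀ one_pos)] with s hs hs1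
    have h1 : |(s - s₀).re| < 1 :=
      (Complex.abs_re_le_norm _).trans_lt (by rwa [← dist_eq_norm])
    rw [sub_re] at h1
    have h2 : |s.re| ≤ |s₀.re| + 1 := by
      have := abs_sub_abs_le_abs_sub s.re s₀.re
      linarith
    have h3 : |s₀.re| ≤ |s.re| + 1 := by
      have := abs_sub_abs_le_abs_sub s₀.re s.re
      rw [abs_sub_comm] at this
      linarith
    refine hs (μ s) ?_ ⟨hμ1 s, ?_⟩
    · have := Nat.ceil_mono h2
      rw [Finset.mem_range]
      simp only [hμ_def]
      omega
    · linarith [hμ s, neg_abs_le s₀.re]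
  have hZ₀ : MeromorphicOn Z₀ Set.univ := fun s _ =>
    (hG (μ s) s (hμ' s)).congr (hloc s).symm
  -- `Z₀` has uncontrolled values at the poles; passing to the normal form changes nothing where the
  -- formula is analytic.
  refine ⟨toMeromorphicNFOn Z₀ Set.univ, meromorphicNFOn_toMeromorphicNFOn _ _, fun s hs => ?_⟩
  rw [← hGS (μ s) (hμ1 s) s hs]
  exact eq_of_meromorphicNFAt_of_analyticAt (meromorphicNFOn_toMeromorphicNFOn _ _ (Set.mem_univ s))
    (analyticAt_qZetaFormula hq0 hq1 le_rfl le_rfl (hμ' s) (notMem_qZetaPoles_of_lt_re hs))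
    ((hZ₀.toMeromorphicNFOn_eq_self_on_nhdsNE (Set.mem_univ s)).trans (hloc s))

theorem isQZeta_qZeta {q : ℝ} (hq0 : 0 < q) (hq1 : q < 1) {ν : ℕ} (hν : 1 ≤ ν) :
    IsQZeta q ν (qZeta q ν) :=
  Classical.epsilon_spec (exists_isQZeta hq0 hq1 hν)

theorem qZeta_eq_qZetaFormula {q : ℝ} (hq0 : 0 < q) (hq1 : q < 1) {ν : ℕ} (hν : 1 ≤ ν)
    {N M n : ℕ} (hN : 1 ≤ N) (hM : 1 ≤ M) (hn : 1 ≤ n) {s : ℂ} (hs : (ν : ℝ) + 1 - M < s.re)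
    (hp : s ∉ qZetaPoles q ν) : qZeta q ν s = qZetaFormula q ν N M n s := by
  have hZ := isQZeta_qZeta hq0 hq1 hν
  refine eq_of_meromorphicNFAt_of_analyticAt (hZ.1 (Set.mem_univ s))
    (analyticAt_qZetaFormula hq0 hq1 hN hn hs hp) ?_
  exact MeromorphicOn.eventuallyEq_nhdsNE_of_re (d := ν)
    (fun s _ => (hZ.1 (Set.mem_univ s)).meromorphicAt)
    (fun s hs => meromorphicAt_qZetaFormula hq0 hq1 hN hn hs)
    (fun s hs => (hZ.2 s hs).trans (qZetaFormula_eq_qSeries hq0 hq1 hν hN hM hn hs).symm) hs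

/-! ### Distribution of the series between main part and remainder. -/

theorem tsum_nonzeroInt {E : Type*} [AddCommMonoid E] [TopologicalSpace E] {f : ℤ → E}
    (h0 : f 0 = 0) : ∑' l : NonzeroInt, f l = ∑' l : ℤ, f l :=
  tsum_subtype_eq_of_support_subset (s := {l : ℤ | l ≠ 0}) fun l hl h => hl (by
    rw [h, h0])

/-- The complement of the finite index set is `OutsideInt l₀ l₁` together with `0`, where `f`
vanishes. -/
theorem sum_add_tsum_outsideInt {f : ℤ → ℂ} (hf : Summable f) (h0 : f 0 = 0) (l₀ l₁ : ℤ) :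
    (∑ l ∈ (Finset.Icc l₀ l₁).filter (fun l => l ≠ 0), f l) + ∑' l : OutsideInt l₀ l₁, f l
      = ∑' l : ℤ, f l := by
  rw [← hf.sum_add_tsum_subtype_compl ((Finset.Icc l₀ l₁).filter (fun l => l ≠ 0))]
  congr 1
  refine (tsum_subtype {l : ℤ | l ≠ 0 ∧ (l < l₀ ∨ l₁ < l)} f).trans
    (Eq.trans (tsum_congr fun l => ?_) (tsum_subtype
      {l : ℤ | l ∉ (Finset.Icc l₀ l₁).filter (fun l => l ≠ 0)} f).symm)
  simp only [Set.indicator_apply, Set.mem_ofPred_eq, Finset.mem_filter, Finset.mem_Icc]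
  by_cases hl : l = 0
  · simp [hl, h0]
  · refine if_congr ?_ rfl rfl
    constructor
    · rintro ⟨_, h⟩ ⟨h', _⟩
      omega
    · intro h
      refine ⟨hl, ?_⟩
      by_contra h'
      push Not at h'
      exact h ⟨⟨by omega, by omega⟩, hl⟩

theorem qMainPart_add_qRemainder {q : ℝ} (hq0 : 0 < q) (hq1 : q < 1) {ν N M n : ℕ}
    (hN : 1 ≤ N) (hn : 1 ≤ n) (l₀ l₁ : ℤ) {s : ℂ} (hs : (ν : ℝ) + 1 - M < s.re) :
    qMainPart s ν q N M n l₀ l₁ + qRemainder s (s - ν) q N M n l₀ l₁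
      = qZetaFormula q ν N M n s := by
  have h1 := summable_fourierTerm hq0 hq1 hN ν M hn s
  have h2 := summable_betaTerm hq0 hq1 hN hn hs
  rw [qZetaFormula, fourierSeries, h1.tsum_add h2,
    ← sum_add_tsum_outsideInt h1 (fourierTerm_zero q _ _ N M hn) l₀ l₁,
    ← tsum_nonzeroInt (betaTerm_zero q _ _ N M hn), qMainPart, qRemainder, qElementaryPart]
  ring

/-! ### The explicit bound for the remainder. -/

/-- Compares factor by factor; applied to `s - ν + j + δl` it removes `l`, since `δl` has real part
zero. -/
theorem abs_rpoch_le_norm_poch (z : ℂ) (k : ℕ) : |rpoch z.re k| ≤ ‖poch z k‖ := by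
  rw [rpoch_eq_prod, poch_eq_prod, Finset.abs_prod, norm_prod]
  refine Finset.prod_le_prod (fun i _ => abs_nonneg _) fun i _ => ?_
  simpa using Complex.abs_re_le_norm (z + i)

theorem rpoch_ne_zero {ν : ℕ} {s : ℂ} (hs : ∀ m : ℕ, s.re ≠ (ν : ℝ) - m) (j k : ℕ) :
    rpoch (s.re - ν + j) k ≠ 0 := by
  rw [rpoch_eq_prod, Finset.prod_ne_zero_iff]
  intro i _ h
  apply hs (j + i)
  push_cast
  linarith

theorem integral_rpow_closed_form {x : ℝ} (hx0 : 0 < x) (hx1 : x < 1) {ν : ℕ} (hν : 1 ≤ ν) {w : ℝ}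
    (hw : (ν : ℝ) < w) :
    ∫ u in (0 : ℝ)..x, u ^ (w - ν - 1) * (1 - u) ^ (1 - w - 1) = -∑ r ∈ Finset.range ν,
      rpoch (-(ν : ℝ) + 1) r / rpoch (-w + 1) (r + 1) * (x ^ (w - ν) * (1 - x) ^ (-w + 1 + r)) := by
  have h := incBeta_closed_form hx0 hx1 hν (w := (w : ℂ)) (by simpa using hw)
  have hx1' : 0 ≤ 1 - x := by linarith
  have e1 : incBeta x (w - ν) (1 - w)
      = ((∫ u in (0 : ℝ)..x, u ^ (w - ν - 1) * (1 - u) ^ (1 - w - 1) : ℝ) : ℂ) := by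
    rw [incBeta, ← intervalIntegral.integral_ofReal, intervalIntegral.integral_of_le hx0.le,
      intervalIntegral.integral_of_le hx0.le]
    refine setIntegral_congr_fun measurableSet_Ioc fun u hu => ?_
    rw [Complex.ofReal_mul, Complex.ofReal_cpow hu.1.le,
      Complex.ofReal_cpow (by linarith [hu.2] : 0 ≤ 1 - u)]
    push_cast
    rfl
  rw [e1] at h
  apply Complex.ofReal_injective
  rw [h]
  push_cast
  congr 1
  refine Finset.sum_congr rfl fun r _ => ?_
  rw [Complex.ofReal_cpow hx0.le, Complex.ofReal_cpow hx1', ofReal_rpoch, ofReal_rpoch]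
  push_cast
  ring

/-- The real majorant has a nonnegative integrand, so its upper limit may be enlarged from `q^N` to
`q` before it is evaluated. -/
theorem norm_incBeta_le_closed_form {q : ℝ} (hq0 : 0 < q) (hq1 : q < 1) {ν : ℕ} (hν : 1 ≤ ν)
    {N M : ℕ} (hN : 1 ≤ N) {s : ℂ} (hs : (ν : ℝ) + 1 - M < s.re) (j : ℕ) (l : ℤ) {x : ℝ}
    (hx : x ∈ ({q ^ N, q} : Set ℝ)) :
    ‖incBeta (q ^ N) (s - ν + j + qDelta q * l + M - 1) (-s - j - M + 2)‖
      ≤ -∑ r ∈ Finset.range ν,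
          rpoch (-(ν : ℝ) + 1) r / rpoch (-s.re - j - M + 2) (r + 1)
            * (x ^ (s.re + j + M - ν - 1) / (1 - x) ^ (s.re + j + M - 2 - r)) := by
  have hqN0 := pow_pos hq0 N
  have hqN1 : q ^ N < 1 := pow_lt_one₀ hq0.le hq1 (by omega)
  obtain ⟨hxN, hx1⟩ : q ^ N ≤ x ∧ x < 1 := by
    rcases hx with rfl | hx
    · exact ⟨le_rfl, hqN1⟩
    · rw [Set.mem_singleton_iff.1 hx]
      exact ⟨pow_le_of_le_one hq0.le hq1.le (by omega), hq1⟩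
  have hx0 := hqN0.trans_le hxN
  -- With this `w` the real parts of the beta parameters are `w - ν` and `1 - w`, as the closed form
  -- requires; `ν < w` is exactly where `Re s > ν + 1 - M` and `j ≥ 0` enter.
  set w : ℝ := s.re + j + M - 1 with hw_def
  have hj : (0 : ℝ) ≤ j := by positivity
  have hw : (ν : ℝ) < w := by
    rw [hw_def]
    linarith
  have hre1 : (s - ν + j + qDelta q * l + M - 1).re = w - ν := by
    simp only [add_re, sub_re, natCast_re, one_re, qDelta_mul_re, hw_def]
    ring
  have hre2 : (-s - j - M + 2).re = 1 - w := by
    simp only [add_re, sub_re, neg_re, natCast_re, hw_def]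
    norm_num
    ring
  have h1 := norm_incBeta_le hqN0 hqN1 (s - ν + j + qDelta q * l + M - 1) (-s - j - M + 2)
  rw [hre1, hre2] at h1
  refine h1.trans ?_
  have h2 : ∫ u in (0 : ℝ)..(q ^ N), u ^ (w - ν - 1) * (1 - u) ^ (1 - w - 1)
      ≤ ∫ u in (0 : ℝ)..x, u ^ (w - ν - 1) * (1 - u) ^ (1 - w - 1) := by
    refine intervalIntegral.integral_mono_interval le_rfl hqN0.le hxN ?_
      (intervalIntegrable_rpow_mul_rpow hx0 hx1 (by linarith) _)
    filter_upwards [ae_restrict_mem measurableSet_Ioc] with u hu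
    exact mul_nonneg (Real.rpow_nonneg hu.1.le _) (Real.rpow_nonneg (by linarith [hu.2]) _)
  refine h2.trans_eq ?_
  rw [integral_rpow_closed_form hx0 hx1 hν hw]
  congr 1
  refine Finset.sum_congr rfl fun r _ => ?_
  rw [show -s.re - j - M + 2 = -w + 1 by rw [hw_def]; ring,
    show s.re + j + M - ν - 1 = w - ν by rw [hw_def]; ring,
    show s.re + j + M - 2 - r = -(-w + 1 + r) by rw [hw_def]; ring,
    Real.rpow_neg (by linarith), div_inv_eq_mul]

theorem norm_two_pi_I_mul_pow (l : ℤ) (n : ℕ) :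
    ‖(2 * Real.pi * Complex.I * l : ℂ) ^ (2 * n)‖ = (2 * Real.pi) ^ (2 * n) * (l : ℝ) ^ (2 * n) := by
  rw [norm_pow, ← mul_pow, norm_mul, norm_mul, norm_mul, Complex.norm_I, Complex.norm_real,
    Complex.norm_intCast, Complex.norm_ofNat, Real.norm_eq_abs, abs_of_pos Real.pi_pos, mul_one,
    mul_pow _ |(l : ℝ)|, pow_mul |(l : ℝ)|, sq_abs, ← pow_mul]
  ring

theorem norm_fourierTerm_le {q : ℝ} (hq0 : 0 < q) (hq1 : q < 1) {ν N : ℕ} (hN : 1 ≤ N)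
    (M n : ℕ) {s : ℂ} (hs : ∀ m : ℕ, s.re ≠ (ν : ℝ) - m) (l : ℤ) :
    ‖fourierTerm q s (s - ν) N M n l‖
      ≤ 1 / (2 * Real.pi) ^ (2 * n) * fourierBoundTerm s ν q N M n l := by
  have hqN1 : 0 < 1 - q ^ N := sub_pos.2 (pow_lt_one₀ hq0.le hq1 (by omega))
  rw [fourierTerm, fourierBoundTerm, Finset.mul_sum]
  refine (norm_sum_le _ _).trans (Finset.sum_le_sum fun j _ => ?_)
  rw [Finset.mul_sum]
  refine (norm_sum_le _ _).trans (Finset.sum_le_sum fun k _ => ?_)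
  have hre : (s - ν + j + qDelta q * l).re = s.re - ν + j := by
    simp only [add_re, sub_re, natCast_re, qDelta_mul_re, add_zero]
  have hp := abs_rpoch_le_norm_poch (s - ν + j + qDelta q * l) k
  rw [hre] at hp
  have e1 : ‖(q : ℂ) ^ ((N : ℂ) * (s - ν + j + k - 1))‖
      = q ^ ((N : ℝ) * (s.re - ν - 1 + j + k)) := by
    rw [Complex.norm_cpow_eq_rpow_re_of_pos hq0]
    congr 1
    simp only [mul_re, add_re, sub_re, natCast_re, natCast_im, one_re, zero_mul, sub_zero]
    ring
  have e2 : ‖((1 - q ^ N : ℝ) : ℂ) ^ (s + j - 1 + k)‖ = (1 - q ^ N) ^ (s.re + j - 1 + k) := by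
    rw [Complex.norm_cpow_eq_rpow_re_of_pos hqN1]
    simp only [add_re, sub_re, natCast_re, one_re]
  rw [norm_mul, norm_mul, norm_div, norm_div, norm_div, norm_two_pi_I_mul_pow, e1, e2, norm_mul,
    norm_pow, norm_neg, norm_one, one_pow, one_mul]
  have h0 : 0 ≤ (l : ℝ) ^ (2 * n) := by
    rw [pow_mul]
    positivity
  calc ‖aCoeff s (s - ν) (2 * n) j‖ / ((2 * Real.pi) ^ (2 * n) * (l : ℝ) ^ (2 * n))
        * (‖poch (s + j) (k - 1)‖ / ‖poch (s - ν + j + qDelta q * l) k‖)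
        * (q ^ ((N : ℝ) * (s.re - ν - 1 + j + k)) / (1 - q ^ N) ^ (s.re + j - 1 + k))
      ≤ ‖aCoeff s (s - ν) (2 * n) j‖ / ((2 * Real.pi) ^ (2 * n) * (l : ℝ) ^ (2 * n))
        * (‖poch (s + j) (k - 1)‖ / |rpoch (s.re - ν + j) k|)
        * (q ^ ((N : ℝ) * (s.re - ν - 1 + j + k)) / (1 - q ^ N) ^ (s.re + j - 1 + k)) := by
        have := abs_pos.2 (rpoch_ne_zero hs j k)
        gcongr
    _ = _ := by ring

theorem norm_betaTerm_le {q : ℝ} (hq0 : 0 < q) (hq1 : q < 1) {ν N M : ℕ} (hν : 1 ≤ ν) (hN : 1 ≤ N)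
    (n : ℕ) {s : ℂ} (hM : (ν : ℝ) + 1 - M < s.re) (hs : ∀ m : ℕ, s.re ≠ (ν : ℝ) - m) (l : ℤ)
    {x : ℝ} (hx : x ∈ ({q ^ N, q} : Set ℝ)) :
    ‖betaTerm q s (s - ν) N M n l‖
      ≤ 1 / (2 * Real.pi) ^ (2 * n) * -betaBoundTerm s ν x M n l := by
  rw [betaTerm, betaBoundTerm, ← Finset.sum_neg_distrib, Finset.mul_sum]
  refine (norm_sum_le _ _).trans (Finset.sum_le_sum fun j _ => ?_)
  have hre : (s - ν + j + qDelta q * l).re = s.re - ν + j := by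
    simp only [add_re, sub_re, natCast_re, qDelta_mul_re, add_zero]
  have hp := abs_rpoch_le_norm_poch (s - ν + j + qDelta q * l) (M - 1)
  rw [hre] at hp
  have hI := norm_incBeta_le_closed_form hq0 hq1 hν hN hM j l hx
  rw [norm_mul, norm_mul, norm_div, norm_div, norm_two_pi_I_mul_pow, norm_mul,
    norm_pow, norm_neg, norm_one, one_pow, one_mul]
  have h0 : 0 ≤ (l : ℝ) ^ (2 * n) := by
    rw [pow_mul]
    positivity
  set I := ∑ r ∈ Finset.range ν, rpoch (-(ν : ℝ) + 1) r / rpoch (-s.re - j - M + 2) (r + 1)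
            * (x ^ (s.re + j + M - ν - 1) / (1 - x) ^ (s.re + j + M - 2 - r))
  calc ‖aCoeff s (s - ν) (2 * n) j‖ / ((2 * Real.pi) ^ (2 * n) * (l : ℝ) ^ (2 * n))
        * (‖poch (s + j) (M - 1)‖ / ‖poch (s - ν + j + qDelta q * l) (M - 1)‖)
        * ‖incBeta (q ^ N) (s - ν + j + qDelta q * l + M - 1) (-s - j - M + 2)‖
      ≤ ‖aCoeff s (s - ν) (2 * n) j‖ / ((2 * Real.pi) ^ (2 * n) * (l : ℝ) ^ (2 * n))
        * (‖poch (s + j) (M - 1)‖ / |rpoch (s.re - ν + j) (M - 1)|) * -I := by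
        -- Replacing the complex Pochhammer denominator by its smaller real counterpart needs the
        -- latter to be positive; this is where the condition on `Re s` enters.
        have := abs_pos.2 (rpoch_ne_zero hs j (M - 1))
        gcongr
    _ = _ := by ring

theorem summable_fourierBoundTerm (s : ℂ) (ν : ℕ) (q : ℝ) (N M : ℕ) {n : ℕ} (hn : 1 ≤ n) :
    Summable fun l : ℤ => fourierBoundTerm s ν q N M n l := by
  unfold fourierBoundTerm
  refine summable_sum fun j _ => summable_sum fun k _ => ?_
  refine Summable.mul_right _ (Summable.mul_right _ ?_)
  refine ((Real.summable_one_div_int_pow.2 (by omega : 1 < 2 * n)).mul_left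
    ‖aCoeff s (s - ν) (2 * n) j‖).congr fun l => ?_
  ring

theorem summable_betaBoundTerm (s : ℂ) (ν : ℕ) (x : ℝ) (M : ℕ) {n : ℕ} (hn : 1 ≤ n) :
    Summable fun l : ℤ => betaBoundTerm s ν x M n l := by
  unfold betaBoundTerm
  refine summable_sum fun j _ => Summable.mul_right _ ?_
  refine ((Real.summable_one_div_int_pow.2 (by omega : 1 < 2 * n)).mul_left
    (‖aCoeff s (s - ν) (2 * n) j‖ * ‖poch (s + j) (M - 1)‖
      / |rpoch (s.re - ν + j) (M - 1)|)).congr fun l => ?_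
  field_simp

theorem norm_qRemainder_le {q : ℝ} (hq0 : 0 < q) (hq1 : q < 1) {ν N M n : ℕ} (hν : 1 ≤ ν)
    (hN : 1 ≤ N) (hn : 1 ≤ n) (l₀ l₁ : ℤ) {s : ℂ} (hM : (ν : ℝ) + 1 - M < s.re)
    (hs : ∀ m : ℕ, s.re ≠ (ν : ℝ) - m) {x : ℝ} (hx : x ∈ ({q ^ N, q} : Set ℝ)) :
    ‖qRemainder s (s - ν) q N M n l₀ l₁‖ ≤ qRemainderBound s ν q N M n l₀ l₁ x := by
  have h1 : ‖∑' l : OutsideInt l₀ l₁, fourierTerm q s (s - ν) N M n l‖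
      ≤ 1 / (2 * Real.pi) ^ (2 * n) * ∑' l : OutsideInt l₀ l₁, fourierBoundTerm s ν q N M n l :=
    tsum_of_norm_bounded
      ((((summable_fourierBoundTerm s ν q N M hn).subtype _).hasSum).mul_left _)
      fun l => norm_fourierTerm_le hq0 hq1 hN M n hs l
  have h2 : ‖∑' l : NonzeroInt, betaTerm q s (s - ν) N M n l‖
      ≤ 1 / (2 * Real.pi) ^ (2 * n) * -∑' l : NonzeroInt, betaBoundTerm s ν x M n l :=
    tsum_of_norm_bounded
      ((((summable_betaBoundTerm s ν x M hn).subtype _).hasSum).neg.mul_left _)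
      fun l => norm_betaTerm_le hq0 hq1 hν hN n hM hs l hx
  have e : ‖(Real.log q : ℂ) ^ (2 * n - 1) * ((1 - q : ℝ) : ℂ) ^ s‖
      = |Real.log q| ^ (2 * n - 1) * (1 - q) ^ s.re := by
    rw [norm_mul, norm_pow, Complex.norm_real, Real.norm_eq_abs,
      Complex.norm_cpow_eq_rpow_re_of_pos (sub_pos.2 hq1)]
  have h0 := Real.rpow_nonneg (sub_nonneg.2 hq1.le) s.re
  rw [qRemainder, norm_mul, e, qRemainderBound]
  calc |Real.log q| ^ (2 * n - 1) * (1 - q) ^ s.re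
        * ‖(∑' l : OutsideInt l₀ l₁, fourierTerm q s (s - ν) N M n l)
          + ∑' l : NonzeroInt, betaTerm q s (s - ν) N M n l‖
      ≤ |Real.log q| ^ (2 * n - 1) * (1 - q) ^ s.re
        * (1 / (2 * Real.pi) ^ (2 * n) * (∑' l : OutsideInt l₀ l₁, fourierBoundTerm s ν q N M n l)
          + 1 / (2 * Real.pi) ^ (2 * n) * -∑' l : NonzeroInt, betaBoundTerm s ν x M n l) :=
        mul_le_mul_of_nonneg_left ((norm_add_le _ _).trans (add_le_add h1 h2)) (by positivity)
    _ = _ := by ring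

end

theorem mainTheorem10 (q : ℝ) (hq0 : 0 < q) (hq1 : q < 1) (ν : ℕ) (hν : 1 ≤ ν)
    (N M n : ℕ) (hN : 1 ≤ N) (hM : 2 ≤ M) (hn : 1 ≤ n) (l₀ l₁ : ℤ) (hl : l₀ < l₁) :
    IsQZeta q ν (qZeta q ν) ∧
    ∀ s : ℂ, (ν : ℝ) + 1 - M < s.re →
      (s ∉ qZetaPoles q ν →
        Summable (fun l : OutsideInt l₀ l₁ => fourierTerm q s (s - ν) N M n l) ∧
        Summable (fun l : NonzeroInt => betaTerm q s (s - ν) N M n l) ∧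
        qZeta q ν s = qMainPart s ν q N M n l₀ l₁ + qRemainder s (s - ν) q N M n l₀ l₁) ∧
      ((∀ m : ℕ, s.re ≠ (ν : ℝ) - m) →
        Summable (fun l : OutsideInt l₀ l₁ => fourierBoundTerm s ν q N M n l) ∧
        (∀ x ∈ ({q ^ N, q} : Set ℝ),
          Summable (fun l : NonzeroInt => betaBoundTerm s ν x M n l) ∧
          ‖qRemainder s (s - ν) q N M n l₀ l₁‖ ≤ qRemainderBound s ν q N M n l₀ l₁ x)) := by
  refine ⟨isQZeta_qZeta hq0 hq1 hν, fun s hs => ⟨fun hp => ⟨?_, ?_, ?_⟩, fun hre => ⟨?_, ?_⟩⟩⟩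
  · exact (summable_fourierTerm hq0 hq1 hN ν M hn s).subtype _
  · exact (summable_betaTerm hq0 hq1 hN hn hs).subtype _
  · rw [qMainPart_add_qRemainder hq0 hq1 hN hn l₀ l₁ hs]
    exact qZeta_eq_qZetaFormula hq0 hq1 hν hN (by omega) hn hs hp
  · exact (summable_fourierBoundTerm s ν q N M hn).subtype _
  · exact fun x hx => ⟨(summable_betaBoundTerm s ν x M hn).subtype _,
      norm_qRemainder_le hq0 hq1 hν hN hn l₀ l₁ hs hre hx⟩
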